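/- Let $\alpha\in(0,1)$ and let $\Omega\subset\mathbb R^3$ be a bounded open set with boundary $\Gamma=\partial\Omega$ of class $C^{2,\alpha}$ (near each boundary point and in suitable Cartesian coordinates, $\Omega$ is the set of points below the graph of a $C^{2,\alpha}$ function) and with connected exterior $\mathbb R^3\setminus\overline\Omega$. Let $\nu$ be the outward unit normal on $\Gamma$ and $ds$ the surface measure. Let $C^{0,\alpha}(\Gamma,\mathbb C^3)$ be the Hölder space with norm $\sum_{i=1}^3\big(\|f_i\|_{C(\Gamma)}+[f_i]_{C^{0,\alpha}(\Gamma)}\big)$, and $C^{1,\alpha}(\Gamma,\mathbb C^3)$ the space of functions whose components have a surface gradient $\nabla_\Gamma f_i\in C^{0,\alpha}(\Gamma,\mathbb C^3)$, with norm $\sum_{i=1}^3\big(\|f_i\|_{C(\Gamma)}+\|\nabla_\Gamma f_i\|_{C^{0,\alpha}(\Gamma,\mathbb C^3)}\big)$. Let $$S_0u(x)=\int_\Gamma\frac{u(y)}{4\pi|x-y|}\,ds(y),\qquad x\in\Gamma,$$ be the scalar Laplace single-layer operator, let $\mathbf S_0$ be the operator that applies $S_0$ to each of the three components of a vector density, and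 put $P_\nu\varphi=(\nu\cdot\varphi)\nu$, $P_t\varphi=\varphi-(\nu\cdot\varphi)\nu$, where $a\cdot b=\sum_i a_ib_i$. For $\varphi\in C^{0,\alpha}(\Gamma,\mathbb C^3)$ define $$C_\nu\varphi=\nu\,S_0(\nu\cdot\varphi)-\mathbf S_0P_\nu\varphi,\qquad C_t\varphi=P_t\mathbf S_0\varphi-\mathbf S_0P_t\varphi .$$ Then the integral defining $S_0u(x)$ converges absolutely for every $u\in C(\Gamma)$ and $x\in\Gamma$, and for all $\varphi\in C^{0,\alpha}(\Gamma,\mathbb C^3)$ and $x\in\Gamma$ $$C_\nu\varphi(x)=\int_\Gamma\frac{\nu(y)\cdot\varphi(y)}{4\pi|x-y|}\,\{\nu(x)-\nu(y)\}\,ds(y),$$ $$C_t\varphi(x)=-\int_\Gamma\frac{1}{4\pi|x-y|}\,\{(\varphi(y)\cdot\nu(x))\,\nu(x)-(\varphi(y)\cdot\nu(y))\,\nu(y)\}\,ds(y),$$ where both integrals converge absolutely. Moreover, $C_\nu$ and $C_t$ are well-defined compact linear operators from $C^{0,\alpha}(\Gamma,\mathbb C^3)$ to $C^{1,\alpha}(\Gamma,\mathbb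 C^3)$. -/

import Mathlib

open MeasureTheory Filter Topology Asymptotics
open scoped NNReal ENNReal

/-- Euclidean space `ℝ³`. -/
abbrev E3 : Type := EuclideanSpace ℝ (Fin 3)

/-- Euclidean plane `ℝ²`. -/
abbrev E2 : Type := EuclideanSpace ℝ (Fin 2)

/-- The embedding `ℝ³ → ℂ³`. -/
noncomputable def toC3 (n : E3) : Fin 3 → ℂ := fun i => (n i : ℂ)

/-- The bilinear dot product `n · v` of a real vector `n` and a complex vector `v`. -/
noncomputable def cdot (n : E3) (v : Fin 3 → ℂ) : ℂ := ∑ i, (n i : ℂ) * v i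

theorem cdot_add_left (v w : E3) (g : Fin 3 → ℂ) : cdot (v + w) g = cdot v g + cdot w g := by
  simp [cdot, add_mul, Finset.sum_add_distrib]

theorem cdot_smul_left (c : ℝ) (v : E3) (g : Fin 3 → ℂ) : cdot (c • v) g = c * cdot v g := by
  simp [cdot, mul_assoc, Finset.mul_sum]

theorem cdot_add_right (v : E3) (g h : Fin 3 → ℂ) : cdot v (g + h) = cdot v g + cdot v h := by
  simp [cdot, mul_add, Finset.sum_add_distrib]

theorem cdot_sub_right (v : E3) (g h : Fin 3 → ℂ) : cdot v (g - h) = cdot v g - cdot v h := by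
  simp [cdot, mul_sub, Finset.sum_sub_distrib]

theorem cdot_smul_right (v : E3) (c : ℂ) (g : Fin 3 → ℂ) : cdot v (c • g) = c * cdot v g := by
  simp [cdot, Finset.mul_sum, mul_left_comm]

section HolderSpace

set_option linter.unusedSectionVars false

variable (X : Type) [MetricSpace X] [CompactSpace X] (α : ℝ≥0)

/-- The `α`-Hölder continuous complex functions on a compact metric space, as a subspace of
the continuous functions. -/
def holderSubmodule : Submodule ℂ C(X, ℂ) where
  carrier := {f | MemHolder α f}
  add_mem' := fun {f g} hf hg => by
    exact MemHolder.add (f := f) (g := g) hf hg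
  zero_mem' := by
    exact (memHolder_const (r := α) (c := (0 : ℂ)) : MemHolder α (Function.const X (0 : ℂ)))
  smul_mem' := fun c f hf => by
    simpa using MemHolder.smul (c := c) (f := f) hf

/-- The Hölder space `C^{0,α}(X)` of complex functions; its norm (defined below) is
`‖f‖_{C(X)} + [f]_{C^{0,α}(X)}`. -/
def HolderC0 : Type := holderSubmodule X α

namespace HolderC0

variable {X α}

noncomputable instance : AddCommGroup (HolderC0 X α) :=
  inferInstanceAs (AddCommGroup (holderSubmodule X α))

noncomputable instance : Module ℂ (HolderC0 X α) :=
  inferInstanceAs (Module ℂ (holderSubmodule X α))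

/-- The underlying continuous function. -/
def toCont (f : HolderC0 X α) : C(X, ℂ) := f.1

noncomputable instance : CoeFun (HolderC0 X α) (fun _ => X → ℂ) := ⟨fun f => f.toCont⟩

theorem memHolder (f : HolderC0 X α) : MemHolder α (f : X → ℂ) := f.2

noncomputable instance : Norm (HolderC0 X α) :=
  ⟨fun f => ‖f.toCont‖ + (nnHolderNorm α (f : X → ℂ) : ℝ)⟩

theorem norm_def (f : HolderC0 X α) :
    ‖f‖ = ‖f.toCont‖ + (nnHolderNorm α (f : X → ℂ) : ℝ) := rfl

theorem toCont_add (f g : HolderC0 X α) : (f + g).toCont = f.toCont + g.toCont := rfl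

theorem toCont_smul (c : ℂ) (f : HolderC0 X α) : (c • f).toCont = c • f.toCont := rfl

theorem normCore : NormedSpace.Core ℂ (HolderC0 X α) where
  norm_nonneg f := by rw [norm_def]; positivity
  norm_smul c f := by
    have h := f.memHolder.nnHolderNorm_smul c
    rw [norm_def, norm_def, toCont_smul, norm_smul, ContinuousMap.coe_smul, h, mul_add]
    simp
  norm_triangle f g := by
    have h := f.memHolder.nnHolderNorm_add_le g.memHolder
    have h' := norm_add_le f.toCont g.toCont
    have h2 : (nnHolderNorm α (⇑f.toCont + ⇑g.toCont) : ℝ) ≤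
        nnHolderNorm α (f : X → ℂ) + nnHolderNorm α (g : X → ℂ) := by exact_mod_cast h
    rw [norm_def, norm_def, norm_def, toCont_add, ContinuousMap.coe_add]
    linarith
  norm_eq_zero_iff f := by
    constructor
    · intro h
      rw [norm_def] at h
      have h0 : ‖f.toCont‖ = 0 :=
        le_antisymm (by have := NNReal.coe_nonneg (nnHolderNorm α (f : X → ℂ)); linarith)
          (norm_nonneg _)
      exact Subtype.ext (norm_eq_zero.mp h0)
    · rintro rfl
      have h0 : (0 : HolderC0 X α).toCont = 0 := rfl
      have h1 : nnHolderNorm α ((0 : HolderC0 X α) : X → ℂ) = 0 := by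
        rw [h0, ContinuousMap.coe_zero]
        exact nnHolderNorm_const X α (0 : ℂ)
      rw [norm_def, h0, norm_zero, zero_add, ← h0, h1, NNReal.coe_zero]

noncomputable instance : NormedAddCommGroup (HolderC0 X α) := .ofCore normCore

noncomputable instance : NormedSpace ℂ (HolderC0 X α) := .ofCore normCore

end HolderC0

/-- The space `C^{0,α}(X, ℂ³)`, with norm `∑ᵢ (‖fᵢ‖_{C(X)} + [fᵢ]_{C^{0,α}(X)})`. -/
abbrev HolderC0Vec : Type := PiLp 1 (fun _ : Fin 3 => HolderC0 X α)

variable {X α}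

/-- The `ℂ³`-valued function on `X` given by an element of `C^{0,α}(X, ℂ³)`. -/
noncomputable def HolderC0Vec.toFun (φ : HolderC0Vec X α) : X → Fin 3 → ℂ := fun x i => φ i x

end HolderSpace

/-- A bounded open set `Ω ⊆ ℝ³` with connected exterior and with boundary of class `C^{2,α}`:
near every boundary point and in suitable Cartesian coordinates, `Ω` is the set of points below
the graph of a `C^{2,α}` function of two variables (such a function, given near one point, may be
multiplied by a smooth cut-off, so it is taken to be defined on the whole plane). -/
structure HolderDomain (α : ℝ≥0) where
  /-- the set `Ω` -/
  carrier : Set E3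
  isOpen : IsOpen carrier
  isBounded : Bornology.IsBounded carrier
  exterior_connected : IsConnected (closure carrier)ᶜ
  local_graph : ∀ p ∈ frontier carrier,
    ∃ (e : E3 ≃ᵃⁱ[ℝ] WithLp 2 (E2 × ℝ)) (f : E2 → ℝ) (W : Set E3),
      ContDiff ℝ 2 f ∧ MemHolder α (fderiv ℝ (fderiv ℝ f)) ∧ IsOpen W ∧ p ∈ W ∧
      ∀ y ∈ W, (y ∈ carrier ↔ (e y).snd < f (e y).fst)

/-- `n` is the outward unit normal at `x` to the boundary of `Ω`: it is a unit vector, it is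
orthogonal to the boundary at `x`, and it points from `Ω` to the exterior. -/
def IsOutwardUnitNormal (Ω : Set E3) (x n : E3) : Prop :=
  ‖n‖ = 1 ∧
  (fun y : E3 => inner ℝ n (y - x)) =o[𝓝[frontier Ω] x] (fun y : E3 => y - x) ∧
  ∀ᶠ t : ℝ in 𝓝[>] 0, x + t • n ∉ closure Ω ∧ x - t • n ∈ Ω

namespace HolderDomain

variable {α : ℝ≥0} (D : HolderDomain α)

/-- The surface `Γ = ∂Ω`, with the metric of `ℝ³`. -/
abbrev Γ : Type := ↥(frontier D.carrier)

instance : CompactSpace D.Γ :=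
  isCompact_iff_compactSpace.mp
    (Metric.isCompact_of_isClosed_isBounded isClosed_frontier
      (D.isBounded.closure.subset frontier_subset_closure))

theorem mem_frontier_of_graph {e : E3 ≃ᵃⁱ[ℝ] WithLp 2 (E2 × ℝ)} {f : E2 → ℝ} {W : Set E3}
    (hf : Continuous f) (hW : IsOpen W)
    (h : ∀ y ∈ W, (y ∈ D.carrier ↔ (e y).snd < f (e y).fst)) {y : E3} (hy : y ∈ W) :
    (y ∈ frontier D.carrier ↔ (e y).snd = f (e y).fst) ∧
      (y ∈ closure D.carrier → (e y).snd ≤ f (e y).fst) := by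
  have hle : y ∈ closure D.carrier → (e y).snd ≤ f (e y).fst := by
    intro hc
    by_contra hlt
    push Not at hlt
    have ho : IsOpen (W ∩ {z | f (e z).fst < (e z).snd}) := by
      refine hW.inter (isOpen_lt ?_ ?_)
      · exact hf.comp ((WithLp.prod_continuous_ofLp 2 E2 ℝ).comp e.continuous).fst
      · exact ((WithLp.prod_continuous_ofLp 2 E2 ℝ).comp e.continuous).snd
    obtain ⟨z, ⟨hzW, hz⟩, hzD⟩ := mem_closure_iff.mp hc _ ho ⟨hy, hlt⟩
    exact lt_asymm ((h z hzW).mp hzD) hz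
  refine ⟨?_, hle⟩
  rw [D.isOpen.frontier_eq]
  constructor
  · rintro ⟨hc, hn⟩
    rw [h y hy] at hn
    exact le_antisymm (hle hc) (not_lt.mp hn)
  · intro heq
    refine ⟨?_, fun hn => ?_⟩
    · let A := e.linearIsometryEquiv
      let c : ℝ → E3 := fun t => A.symm (WithLp.toLp 2 (0, -t)) +ᵥ y
      have hec : ∀ t, e (c t) = WithLp.toLp 2 (0, -t) + e y := fun t => by
        have := e.map_vadd y (A.symm (WithLp.toLp 2 (0, -t)))
        rw [LinearIsometryEquiv.apply_symm_apply] at this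
        exact this
      have hcc : Continuous c := by
        have : Continuous fun t : ℝ => WithLp.toLp 2 ((0 : E2), -t) :=
          (WithLp.prod_continuous_toLp 2 E2 ℝ).comp (by fun_prop)
        exact (A.symm.continuous.comp this).add continuous_const
      have hc0 : c 0 = y := by simp [c]
      refine mem_closure_of_tendsto (f := c) (b := 𝓝[>] (0 : ℝ)) ?_ ?_
      · have := hcc.tendsto 0
        rw [hc0] at this
        exact this.mono_left nhdsWithin_le_nhds
      · have hW' : ∀ᶠ t in 𝓝[>] (0 : ℝ), c t ∈ W := by
          refine nhdsWithin_le_nhds (hcc.continuousAt.preimage_mem_nhds ?_)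
          rw [hc0]
          exact hW.mem_nhds hy
        filter_upwards [hW', self_mem_nhdsWithin] with t ht ht0
        rw [h _ ht, hec]
        have : (0 : ℝ) < t := ht0
        simp [heq, this]
    · rw [h y hy, heq] at hn
      exact lt_irrefl _ hn

theorem exists_curve (x : D.Γ) : ∃ (A : E3 ≃ₗᵢ[ℝ] WithLp 2 (E2 × ℝ)) (T : E2 →L[ℝ] ℝ),
    (∃ n, IsOutwardUnitNormal D.carrier x n) ∧
    ∀ w : E2, ∃ c : ℝ → E3, c 0 = x ∧ (∀ᶠ t in 𝓝 (0 : ℝ), c t ∈ frontier D.carrier) ∧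
      HasDerivAt c (A.symm (WithLp.toLp 2 (w, T w))) 0 := by
  obtain ⟨e, f, W, hf2, -, hW, hxW, h⟩ := D.local_graph x x.2
  have hf : Continuous f := hf2.continuous
  let A := e.linearIsometryEquiv
  set a : E2 := (e x).fst with ha
  have hfd : HasFDerivAt f (fderiv ℝ f a) a :=
    (hf2.differentiable (by norm_num)).differentiableAt.hasFDerivAt
  have hxf : (e x).snd = f a := (D.mem_frontier_of_graph hf hW h hxW).1.mp x.2
  have heA : ∀ v : E3, e (v +ᵥ (x : E3)) = A v + e x := fun v =>
    e.map_vadd (x : E3) v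
  refine ⟨A, fderiv ℝ f a, ?_, ?_⟩
  · obtain ⟨G, hG⟩ : ∃ G : E2, ∀ w, fderiv ℝ f a w = inner ℝ G w :=
      ⟨(InnerProductSpace.toDual ℝ E2).symm (fderiv ℝ f a), fun w => by simp⟩
    let m : E3 := A.symm (WithLp.toLp 2 (-G, 1))
    have hAm : A m = WithLp.toLp 2 (-G, 1) := by simp [m]
    have hm0 : m ≠ 0 := by
      intro h0
      rw [h0, map_zero] at hAm
      have := congrArg WithLp.snd hAm
      simp at this
    have hmpos : 0 < ‖m‖ := norm_pos_iff.mpr hm0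
    -- the height of `x + t m` above the graph
    let d : ℝ → ℝ := fun t => (f a + t) - f (a - t • G)
    have hd : HasDerivAt d (1 + ‖G‖ ^ 2) 0 := by
      have h1 : HasDerivAt (fun t : ℝ => a - t • G) (-G) 0 := by
        simpa using ((hasDerivAt_id (0 : ℝ)).smul_const G).const_sub a
      have h2 : HasDerivAt (fun t : ℝ => f (a - t • G)) (fderiv ℝ f a (-G)) 0 := by
        refine HasFDerivAt.comp_hasDerivAt (0 : ℝ) ?_ h1
        simpa using hfd
      have h3 := ((hasDerivAt_id (0 : ℝ)).const_add (f a)).sub h2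
      have e1 : (1 : ℝ) - fderiv ℝ f a (-G) = 1 + ‖G‖ ^ 2 := by
        rw [hG, inner_neg_right, real_inner_self_eq_norm_sq]; ring
      rw [e1] at h3
      exact h3
    have hd0 : d 0 = 0 := by simp [d]
    have hslope : ∀ᶠ t in 𝓝[≠] (0 : ℝ), 0 < slope d 0 t :=
      (hasDerivAt_iff_tendsto_slope.mp hd).eventually (lt_mem_nhds (by positivity))
    have hcurve : ∀ t : ℝ, e ((x : E3) + t • m) = WithLp.toLp 2 (a - t • G, f a + t) := by
      intro t
      have : (x : E3) + t • m = (t • m) +ᵥ (x : E3) := by simp [add_comm]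
      rw [this, heA, map_smul, hAm]
      refine WithLp.ofLp_injective 2 (Prod.ext ?_ ?_)
      · simp [← ha]; abel
      · simp [hxf, add_comm]
    have hWm : ∀ᶠ t in 𝓝 (0 : ℝ), (x : E3) + t • m ∈ W := by
      have : Continuous fun t : ℝ => (x : E3) + t • m := by fun_prop
      refine this.continuousAt.preimage_mem_nhds ?_
      simpa using hW.mem_nhds hxW
    have hout : ∀ᶠ t in 𝓝[>] (0 : ℝ), (x : E3) + t • m ∉ closure D.carrier := by
      have h1 : ∀ᶠ t in 𝓝[>] (0 : ℝ), 0 < slope d 0 t :=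
        hslope.filter_mono (nhdsWithin_mono _ (fun t (ht : (0 : ℝ) < t) => ht.ne'))
      filter_upwards [h1, nhdsWithin_le_nhds hWm, self_mem_nhdsWithin] with t ht htW ht0 hc
      have ht0 : (0 : ℝ) < t := ht0
      have h2 := (D.mem_frontier_of_graph hf hW h htW).2 hc
      rw [hcurve] at h2
      have h3 : d t ≤ 0 := by simpa [d] using h2
      rw [slope_def_field, hd0, sub_zero, sub_zero] at ht
      have := (div_pos_iff_of_pos_right ht0).mp ht
      linarith
    have hin : ∀ᶠ t in 𝓝[<] (0 : ℝ), (x : E3) + t • m ∈ D.carrier := by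
      have h1 : ∀ᶠ t in 𝓝[<] (0 : ℝ), 0 < slope d 0 t :=
        hslope.filter_mono (nhdsWithin_mono _ (fun t (ht : t < (0 : ℝ)) => ht.ne))
      filter_upwards [h1, nhdsWithin_le_nhds hWm, self_mem_nhdsWithin] with t ht htW ht0
      have ht0 : t < (0 : ℝ) := ht0
      rw [h _ htW, hcurve]
      rw [slope_def_field, hd0, sub_zero, sub_zero] at ht
      have h3 : d t < 0 := by
        by_contra h4
        push Not at h4
        exact absurd ht (not_lt.mpr (div_nonpos_of_nonneg_of_nonpos h4 ht0.le))
      have h5 : f a + t - f (a - t • G) < 0 := h3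
      have h6 : f a + t < f (a - t • G) := by linarith
      exact h6
    refine ⟨‖m‖⁻¹ • m, ?_, ?_, ?_⟩
    · rw [norm_smul, norm_inv, norm_norm, inv_mul_cancel₀ hmpos.ne']
    · have hm : (fun y : E3 => inner ℝ m (y - x)) =o[𝓝[frontier D.carrier] (x : E3)]
          (fun y : E3 => y - x) := by
        have ht : Tendsto (fun y : E3 => (e y).fst) (𝓝[frontier D.carrier] (x : E3)) (𝓝 a) :=
          ((((WithLp.prod_continuous_ofLp 2 E2 ℝ).comp e.continuous).fst).tendsto
            (x : E3)).mono_left nhdsWithin_le_nhds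
        have h1 := hfd.isLittleO.comp_tendsto ht
        have h2 : (fun y : E3 => (e y).fst - a) =O[𝓝[frontier D.carrier] (x : E3)]
            (fun y : E3 => y - x) := by
          refine IsBigO.of_bound 1 (Eventually.of_forall fun y => ?_)
          have h3 : ‖e y - e x‖ = ‖y - x‖ := by
            rw [← dist_eq_norm, ← dist_eq_norm, e.dist_map]
          rw [one_mul, ← h3]
          have := WithLp.prod_norm_sq_eq_of_L2 (e y - e x)
          have h4 : ‖(e y).fst - a‖ = ‖(e y - e x).fst‖ := by simp [ha]
          rw [h4]
          refine (sq_le_sq₀ (norm_nonneg _) (norm_nonneg _)).mp ?_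
          nlinarith [sq_nonneg ‖(e y - e x).snd‖]
        refine (h1.trans_isBigO h2).congr' ?_ EventuallyEq.rfl
        filter_upwards [self_mem_nhdsWithin, nhdsWithin_le_nhds (hW.mem_nhds hxW)] with y hy hyW
        have hyf := (D.mem_frontier_of_graph hf hW h hyW).1.mp hy
        have h5 : A (y - x) = e y - e x := by
          have := e.map_vsub y (x : E3)
          simpa [A] using this
        have h6 : inner ℝ m (y - x) = inner ℝ (A m) (A (y - x)) := (A.inner_map_map _ _).symm
        rw [h6, hAm, h5, WithLp.prod_inner_apply]
        simp only [Function.comp_apply, WithLp.ofLp_sub, Prod.fst_sub, Prod.snd_sub]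
        have h7 : inner ℝ (1 : ℝ) ((e y).snd - (e x).snd) = (e y).snd - (e x).snd := by simp
        have h8 : inner ℝ (-G) ((e y).fst - a) = - fderiv ℝ f a ((e y).fst - a) := by
          rw [hG, inner_neg_left]
        change _ = inner ℝ (-G) ((e y).fst - a) + inner ℝ (1 : ℝ) ((e y).snd - (e x).snd)
        rw [h7, h8, hyf, hxf]
        ring
      refine (hm.const_mul_left ‖m‖⁻¹).congr_left fun y => ?_
      rw [real_inner_smul_left]
    · have hpos : 0 < ‖m‖⁻¹ := inv_pos.mpr hmpos
      have hs1 : Tendsto (fun t : ℝ => t * ‖m‖⁻¹) (𝓝[>] 0) (𝓝[>] 0) := by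
        refine tendsto_nhdsWithin_iff.mpr ⟨?_, ?_⟩
        · have : Continuous fun t : ℝ => t * ‖m‖⁻¹ := by fun_prop
          simpa using (this.tendsto 0).mono_left nhdsWithin_le_nhds
        · filter_upwards [self_mem_nhdsWithin] with t ht
          exact mul_pos ht hpos
      have hs2 : Tendsto (fun t : ℝ => -(t * ‖m‖⁻¹)) (𝓝[>] 0) (𝓝[<] 0) := by
        refine tendsto_nhdsWithin_iff.mpr ⟨?_, ?_⟩
        · have : Continuous fun t : ℝ => -(t * ‖m‖⁻¹) := by fun_prop
          simpa using (this.tendsto 0).mono_left nhdsWithin_le_nhds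
        · filter_upwards [self_mem_nhdsWithin] with t ht
          exact neg_neg_of_pos (mul_pos ht hpos)
      filter_upwards [hs1.eventually hout, hs2.eventually hin] with t h1 h2
      rw [smul_smul]
      exact ⟨h1, by rwa [neg_smul, ← sub_eq_add_neg] at h2⟩
  · intro w
    refine ⟨fun t => (x : E3) + A.symm (WithLp.toLp 2 (t • w, f (a + t • w) - f a)), ?_, ?_, ?_⟩
    · have : WithLp.toLp 2 ((0 : ℝ) • w, f (a + (0 : ℝ) • w) - f a) = 0 := by simp
      simp only [this, map_zero, add_zero]
    · have hcont : Continuous fun t : ℝ =>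
          (x : E3) + A.symm (WithLp.toLp 2 (t • w, f (a + t • w) - f a)) := by
        have : Continuous fun t : ℝ => WithLp.toLp 2 (t • w, f (a + t • w) - f a) :=
          (WithLp.prod_continuous_toLp 2 E2 ℝ).comp (by fun_prop)
        exact continuous_const.add (A.symm.continuous.comp this)
      have hW' : ∀ᶠ t in 𝓝 (0 : ℝ),
          (x : E3) + A.symm (WithLp.toLp 2 (t • w, f (a + t • w) - f a)) ∈ W := by
        refine hcont.continuousAt.preimage_mem_nhds ?_
        have h0 : (x : E3) + A.symm (WithLp.toLp 2 ((0 : ℝ) • w, f (a + (0 : ℝ) • w) - f a)) = x := by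
          have : WithLp.toLp 2 ((0 : ℝ) • w, f (a + (0 : ℝ) • w) - f a) = 0 := by simp
          rw [this, map_zero, add_zero]
        rw [h0]
        exact hW.mem_nhds hxW
      filter_upwards [hW'] with t ht
      rw [(D.mem_frontier_of_graph hf hW h ht).1]
      have : (x : E3) + A.symm (WithLp.toLp 2 (t • w, f (a + t • w) - f a)) =
          A.symm (WithLp.toLp 2 (t • w, f (a + t • w) - f a)) +ᵥ (x : E3) := by simp [add_comm]
      rw [this, heA]
      simp [hxf, ← ha, add_comm]
    · have h1 : HasDerivAt (fun t : ℝ => a + t • w) w 0 := by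
        simpa using ((hasDerivAt_id (0 : ℝ)).smul_const w).const_add a
      have h2 : HasDerivAt (fun t : ℝ => f (a + t • w)) (fderiv ℝ f a w) 0 := by
        refine HasFDerivAt.comp_hasDerivAt (0 : ℝ) ?_ h1
        simpa using hfd
      have h3 : HasDerivAt (fun t : ℝ => t • w) w 0 := by
        simpa using (hasDerivAt_id (0 : ℝ)).smul_const w
      have h4 : HasDerivAt (fun t : ℝ => (t • w, f (a + t • w) - f a)) (w, fderiv ℝ f a w) 0 :=
        h3.prodMk (h2.sub_const _)
      let B : (E2 × ℝ) →L[ℝ] E3 :=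
        (A.symm.toContinuousLinearEquiv : WithLp 2 (E2 × ℝ) →L[ℝ] E3).comp
          ((WithLp.prodContinuousLinearEquiv 2 ℝ E2 ℝ).symm : (E2 × ℝ) →L[ℝ] WithLp 2 (E2 × ℝ))
      exact (B.hasFDerivAt.comp_hasDerivAt (0 : ℝ) h4).const_add (x : E3)

theorem exists_isOutwardUnitNormal (x : D.Γ) : ∃ n, IsOutwardUnitNormal D.carrier x n := by
  obtain ⟨_, _, h, _⟩ := D.exists_curve x
  exact h

/-- A real-linear map that is `o(|y - x|)` along the surface vanishes along curves. -/
theorem eq_zero_of_isLittleO {x : D.Γ} {V : Type} [NormedAddCommGroup V] [NormedSpace ℝ V]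
    {L : E3 →L[ℝ] V}
    (hL : (fun y : E3 => L (y - x)) =o[𝓝[frontier D.carrier] (x : E3)] (fun y : E3 => y - x))
    {c : ℝ → E3} {v : E3} (hc0 : c 0 = x) (hc : ∀ᶠ t in 𝓝 (0 : ℝ), c t ∈ frontier D.carrier)
    (hv : HasDerivAt c v 0) : L v = 0 := by
  have ht : Tendsto c (𝓝 0) (𝓝[frontier D.carrier] (x : E3)) := by
    refine tendsto_nhdsWithin_iff.mpr ⟨?_, hc⟩
    have := hv.continuousAt.tendsto
    rwa [hc0] at this
  have h1 := hL.comp_tendsto ht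
  have h2 : (fun t : ℝ => c t - x) =O[𝓝 0] (fun t : ℝ => t) := by
    have := hv.isBigO_sub
    simpa [hc0] using this
  have h3 : (fun t : ℝ => L (c t - x)) =o[𝓝 0] (fun t : ℝ => t) := h1.trans_isBigO h2
  have h4 : HasDerivAt (fun t : ℝ => L (c t - x)) 0 0 := by
    rw [hasDerivAt_iff_isLittleO]
    simpa [hc0] using h3
  have h5 : HasDerivAt (fun t : ℝ => L (c t - x)) (L v) 0 :=
    L.hasFDerivAt.comp_hasDerivAt (0 : ℝ) (hv.sub_const (x : E3))
  exact h5.unique h4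

/-- A real-linear map that is `o(|y - x|)` along the surface and vanishes on a normal vanishes. -/
theorem eq_zero_of_normal {x : D.Γ} {V : Type} [NormedAddCommGroup V] [NormedSpace ℝ V]
    {L : E3 →L[ℝ] V}
    (hL : (fun y : E3 => L (y - x)) =o[𝓝[frontier D.carrier] (x : E3)] (fun y : E3 => y - x))
    {n : E3} (hn : IsOutwardUnitNormal D.carrier x n) (hLn : L n = 0) : L = 0 := by
  obtain ⟨A, T, -, hcurve⟩ := D.exists_curve x
  have htan : ∀ w : E2, L (A.symm (WithLp.toLp 2 (w, T w))) = 0 := fun w => by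
    obtain ⟨c, h0, h1, h2⟩ := hcurve w
    exact D.eq_zero_of_isLittleO hL h0 h1 h2
  have hntan : ∀ w : E2, inner ℝ n (A.symm (WithLp.toLp 2 (w, T w))) = 0 := fun w => by
    obtain ⟨c, h0, h1, h2⟩ := hcurve w
    exact D.eq_zero_of_isLittleO (L := innerSL ℝ n) hn.2.1 h0 h1 h2
  have hdec : ∀ v : E3, v = A.symm (WithLp.toLp 2 ((A v).fst, T (A v).fst)) +
      ((A v).snd - T (A v).fst) • A.symm (WithLp.toLp 2 ((0 : E2), (1 : ℝ))) := fun v => by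
    apply A.injective
    rw [map_add, map_smul, A.apply_symm_apply, A.apply_symm_apply]
    refine WithLp.ofLp_injective 2 (Prod.ext ?_ ?_) <;> simp
  have hv0 : L (A.symm (WithLp.toLp 2 ((0 : E2), (1 : ℝ)))) = 0 := by
    have h1 := hLn
    rw [hdec n, map_add, htan, zero_add, map_smul] at h1
    rcases smul_eq_zero.mp h1 with h2 | h2
    · exfalso
      have h3 := hdec n
      rw [h2, zero_smul, add_zero] at h3
      have h4 := hntan (A n).fst
      rw [← h3, real_inner_self_eq_norm_sq, hn.1] at h4
      norm_num at h4
    · exact h2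
  ext v
  rw [hdec v, map_add, htan, zero_add, map_smul, hv0, smul_zero]
  rfl

/-- The outward unit normal `ν` on `Γ`. -/
noncomputable def normal (x : D.Γ) : E3 := (D.exists_isOutwardUnitNormal x).choose

theorem normal_spec (x : D.Γ) : IsOutwardUnitNormal D.carrier x (D.normal x) :=
  (D.exists_isOutwardUnitNormal x).choose_spec

theorem normal_unique (x : D.Γ) {n : E3} (hn : IsOutwardUnitNormal D.carrier x n) :
    n = D.normal x := by
  have hm := D.normal_spec x
  set m := D.normal x with hmdef
  let L : E3 →L[ℝ] ℝ := innerSL ℝ (n - (inner ℝ n m : ℝ) • m)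
  have hLv : ∀ v, L v = inner ℝ n v - inner ℝ n m * inner ℝ m v := fun v => by
    change inner ℝ (n - (inner ℝ n m : ℝ) • m) v = _
    rw [inner_sub_left, real_inner_smul_left]
  have hL : L = 0 := by
    refine D.eq_zero_of_normal (x := x) ?_ hm ?_
    · refine (hn.2.1.sub (hm.2.1.const_mul_left (inner ℝ n m))).congr_left fun y => ?_
      rw [hLv]
    · rw [hLv, real_inner_self_eq_norm_sq, hm.1]
      ring
  have hnm : n = (inner ℝ n m : ℝ) • m := by
    have h1 : L (n - (inner ℝ n m : ℝ) • m) = 0 := by rw [hL]; rfl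
    have h2 : inner ℝ (n - (inner ℝ n m : ℝ) • m) (n - (inner ℝ n m : ℝ) • m) = (0 : ℝ) := h1
    exact sub_eq_zero.mp (inner_self_eq_zero.mp h2)
  have habs : |(inner ℝ n m : ℝ)| = 1 := by
    have h1 := congrArg norm hnm
    rw [norm_smul, hn.1, hm.1, mul_one, Real.norm_eq_abs] at h1
    exact h1.symm
  rcases (abs_eq zero_le_one).mp habs with h1 | h1
  · rw [h1, one_smul] at hnm
    exact hnm
  · exfalso
    rw [h1, neg_one_smul] at hnm
    obtain ⟨t, h2, h3⟩ := (hn.2.2.and hm.2.2).exists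
    refine h2.1 (subset_closure ?_)
    rw [hnm, smul_neg, ← sub_eq_add_neg]
    exact h3.2

/-- `g` is the surface gradient at `x` of the function `f` on `Γ`: it is tangential, and
`f(y) = f(x) + g · (y - x) + o(|y - x|)` as `y → x` on `Γ`. -/
def HasSurfaceGradientAt (f : D.Γ → ℂ) (g : Fin 3 → ℂ) (x : D.Γ) : Prop :=
  cdot (D.normal x) g = 0 ∧
  (fun y : D.Γ => f y - f x - cdot ((y : E3) - x) g) =o[𝓝 x] (fun y : D.Γ => (y : E3) - x)

theorem HasSurfaceGradientAt.unique {D : HolderDomain α} {f : D.Γ → ℂ} {g g' : Fin 3 → ℂ} {x : D.Γ}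
    (h : D.HasSurfaceGradientAt f g x) (h' : D.HasSurfaceGradientAt f g' x) : g = g' := by
  let L : E3 →L[ℝ] ℂ := LinearMap.toContinuousLinearMap
    { toFun := fun v => cdot v (g - g')
      map_add' := fun v w => cdot_add_left v w _
      map_smul' := fun c v => by simpa using cdot_smul_left c v (g - g') }
  have hLv : ∀ v, L v = cdot v g - cdot v g' := fun v => cdot_sub_right v g g'
  have hL : L = 0 := by
    refine D.eq_zero_of_normal (x := x) ?_ (D.normal_spec x) ?_
    · have h1 : (fun y : D.Γ => L ((y : E3) - x)) =o[𝓝 x] (fun y : D.Γ => (y : E3) - x) := by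
        refine (h'.2.sub h.2).congr_left fun y => ?_
        rw [hLv]
        ring
      rw [nhdsWithin_eq_map_subtype_coe x.2, isLittleO_map]
      exact h1
    · rw [hLv, h.1, h'.1, sub_zero]
  funext i
  have h1 : L (EuclideanSpace.single i 1) = 0 := by rw [hL]; rfl
  rw [hLv] at h1
  have h2 : ∀ k : Fin 3 → ℂ, cdot (EuclideanSpace.single i (1 : ℝ)) k = k i := fun k => by
    rw [cdot, Finset.sum_eq_single i]
    · simp
    · intro j _ hj
      simp [hj]
    · simp
  rw [h2, h2] at h1
  exact sub_eq_zero.mp h1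

/-- The pairs `(f, ∇_Γ f)` of a function `f` on `Γ` and its surface gradient, where the latter
exists everywhere and lies in `C^{0,α}(Γ, ℂ³)`. The norm of the ambient space is
`‖(f, g)‖ = ‖f‖_{C(Γ)} + ‖g‖_{C^{0,α}(Γ, ℂ³)}`. -/
noncomputable def holderC1Submodule : Submodule ℂ (WithLp 1 (C(D.Γ, ℂ) × HolderC0Vec D.Γ α)) where
  carrier := {p | ∀ x, D.HasSurfaceGradientAt p.fst (HolderC0Vec.toFun p.snd x) x}
  add_mem' := fun {p q} hp hq x => by
    refine ⟨?_, ((hp x).2.add (hq x).2).congr_left fun y => ?_⟩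
    · have h := cdot_add_right (D.normal x) (HolderC0Vec.toFun p.snd x) (HolderC0Vec.toFun q.snd x)
      rw [(hp x).1, (hq x).1, add_zero] at h
      exact h
    · have h := cdot_add_right ((y : E3) - x) (HolderC0Vec.toFun p.snd x)
        (HolderC0Vec.toFun q.snd x)
      change _ = (p.fst y + q.fst y) - (p.fst x + q.fst x) - cdot ((y : E3) - x)
        (HolderC0Vec.toFun p.snd x + HolderC0Vec.toFun q.snd x)
      rw [h]
      ring
  zero_mem' := fun x => by
    have h0 : HolderC0Vec.toFun (0 : HolderC0Vec D.Γ α) x = 0 := rfl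
    refine ⟨?_, (isLittleO_zero _ _).congr_left fun y => ?_⟩
    · change cdot _ (HolderC0Vec.toFun (0 : HolderC0Vec D.Γ α) x) = 0
      rw [h0]
      simp [cdot]
    · change (0 : ℂ) = 0 - 0 - cdot _ (HolderC0Vec.toFun (0 : HolderC0Vec D.Γ α) x)
      rw [h0]
      simp [cdot]
  smul_mem' := fun c p hp x => by
    refine ⟨?_, ((hp x).2.const_mul_left c).congr_left fun y => ?_⟩
    · have h := cdot_smul_right (D.normal x) c (HolderC0Vec.toFun p.snd x)
      rw [(hp x).1, mul_zero] at h
      exact h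
    · have h := cdot_smul_right ((y : E3) - x) c (HolderC0Vec.toFun p.snd x)
      change _ = c * p.fst y - c * p.fst x - cdot ((y : E3) - x)
        (c • HolderC0Vec.toFun p.snd x)
      rw [h]
      ring

/-- The space `C^{1,α}(Γ)` of the functions `f` on `Γ` whose surface gradient `∇_Γ f` exists
everywhere and lies in `C^{0,α}(Γ, ℂ³)`, with norm `‖f‖_{C(Γ)} + ‖∇_Γ f‖_{C^{0,α}(Γ, ℂ³)}`.
It is realized as the set of the pairs `(f, ∇_Γ f)`; as the surface gradient is unique, such a
pair is determined by `f` (`HolderC1.ext`). -/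
def HolderC1 : Type := D.holderC1Submodule

namespace HolderC1

noncomputable instance : NormedAddCommGroup D.HolderC1 :=
  inferInstanceAs (NormedAddCommGroup D.holderC1Submodule)

noncomputable instance : NormedSpace ℂ D.HolderC1 :=
  inferInstanceAs (NormedSpace ℂ D.holderC1Submodule)

variable {D}

/-- The underlying continuous function. -/
noncomputable def toCont (f : D.HolderC1) : C(D.Γ, ℂ) := f.1.fst

/-- The surface gradient. -/
noncomputable def grad (f : D.HolderC1) : HolderC0Vec D.Γ α := f.1.snd

noncomputable instance : CoeFun D.HolderC1 (fun _ => D.Γ → ℂ) := ⟨fun f => f.toCont⟩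

theorem hasSurfaceGradientAt (f : D.HolderC1) (x : D.Γ) :
    D.HasSurfaceGradientAt f (f.grad.toFun x) x := f.2 x

theorem norm_def (f : D.HolderC1) : ‖f‖ = ‖f.toCont‖ + ‖f.grad‖ :=
  WithLp.prod_norm_eq_of_L1 f.1

theorem ext {f g : D.HolderC1} (h : ∀ x, f x = g x) : f = g := by
  have h1 : f.toCont = g.toCont := ContinuousMap.ext h
  have h2 : f.grad = g.grad := by
    ext i
    refine Subtype.ext (ContinuousMap.ext fun x => ?_)
    have hg := g.hasSurfaceGradientAt x
    rw [← h1] at hg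
    exact congrFun ((f.hasSurfaceGradientAt x).unique hg) i
  exact Subtype.ext (WithLp.ofLp_injective 1 (Prod.ext h1 h2))

end HolderC1

/-- The space `C^{1,α}(Γ, ℂ³)`, with norm `∑ᵢ ‖fᵢ‖_{C^{1,α}(Γ)}`. -/
abbrev HolderC1Vec : Type := PiLp 1 (fun _ : Fin 3 => D.HolderC1)

variable {D} in
/-- The `ℂ³`-valued function on `Γ` given by an element of `C^{1,α}(Γ, ℂ³)`. -/
noncomputable def HolderC1Vec.toFun (φ : D.HolderC1Vec) : D.Γ → Fin 3 → ℂ :=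
  fun x i => φ i x

/-- The surface measure `ds` on `Γ`: the two-dimensional Hausdorff measure, normalized so that
it is Lebesgue measure on the plane. -/
noncomputable def surfaceMeasure : Measure D.Γ := μHE[2]

/-- The fundamental solution `1 / (4π|x - y|)` of the Laplace equation. -/
noncomputable def laplaceKernel (x y : D.Γ) : ℂ := ((1 / (4 * Real.pi * ‖(x : E3) - y‖) : ℝ) : ℂ)

/-- The scalar Laplace single-layer operator `S₀`. -/
noncomputable def singleLayer (u : D.Γ → ℂ) (x : D.Γ) : ℂ :=
  ∫ y, D.laplaceKernel x y * u y ∂D.surfaceMeasure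

/-- The vector Laplace single-layer operator, acting componentwise. -/
noncomputable def vecSingleLayer (φ : D.Γ → Fin 3 → ℂ) (x : D.Γ) : Fin 3 → ℂ :=
  fun i => D.singleLayer (fun y => φ y i) x

/-- The function `ν · φ`. -/
noncomputable def normalDot (φ : D.Γ → Fin 3 → ℂ) (x : D.Γ) : ℂ := cdot (D.normal x) (φ x)

/-- The normal projector `P_ν φ = (ν · φ) ν`. -/
noncomputable def projNormal (φ : D.Γ → Fin 3 → ℂ) (x : D.Γ) : Fin 3 → ℂ :=
  D.normalDot φ x • toC3 (D.normal x)

/-- The tangential projector `P_t φ = φ - (ν · φ) ν`. -/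
noncomputable def projTangential (φ : D.Γ → Fin 3 → ℂ) (x : D.Γ) : Fin 3 → ℂ :=
  φ x - D.projNormal φ x

/-- The commutator `C_ν φ = ν S₀(ν · φ) - S₀ P_ν φ`. -/
noncomputable def commNormal (φ : D.Γ → Fin 3 → ℂ) (x : D.Γ) : Fin 3 → ℂ :=
  D.singleLayer (D.normalDot φ) x • toC3 (D.normal x) - D.vecSingleLayer (D.projNormal φ) x

/-- The commutator `C_t φ = P_t S₀ φ - S₀ P_t φ`. -/
noncomputable def commTangential (φ : D.Γ → Fin 3 → ℂ) (x : D.Γ) : Fin 3 → ℂ :=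
  D.projTangential (D.vecSingleLayer φ) x - D.vecSingleLayer (D.projTangential φ) x

/-- The integrand of the integral representation of `C_ν`. -/
noncomputable def commNormalIntegrand (φ : D.Γ → Fin 3 → ℂ) (x y : D.Γ) : Fin 3 → ℂ :=
  (cdot (D.normal y) (φ y) * D.laplaceKernel x y) • (toC3 (D.normal x) - toC3 (D.normal y))

/-- The integrand of the integral representation of `C_t`. -/
noncomputable def commTangentialIntegrand (φ : D.Γ → Fin 3 → ℂ) (x y : D.Γ) : Fin 3 → ℂ :=
  D.laplaceKernel x y • (cdot (D.normal x) (φ y) • toC3 (D.normal x) -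
    cdot (D.normal y) (φ y) • toC3 (D.normal y))

end HolderDomain

/-! In components both commutators are integral operators with kernel (q(x) - q(y)) / (4π|x - y|).
For `commNormal` the multiplier q is ν_i and the density is ν·φ. For `commTangential`, up to sign, q
runs over the products ν_i ν_j with densities φ_j, because the identity part of P_t commutes with
the single layer. Since Γ is of class C^{2,α}, the normal is locally the restriction of a C^{1,α}
field (`exists_extension_normal`), so q is Lipschitz with an α-Hölder surface gradient g
(`exists_isC1Holder_comp_normal`).

The difference q(x) - q(y) cancels the singularity: the kernel is bounded, and its gradient in x is,
up to the factor 1/(4π), g(x)/|x - y| - (q(x) - q(y))(x - y)/|x - y|^3, which is only of order |x -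
y|^{-1}. Dominated convergence then allows differentiation under the integral
(`IsC1Holder.hasAmbientGradientAt_commPotential`). Weakly singular kernels of this order map bounded
densities to α-Hölder functions (`WeaklySingular.holderBound`): a size bound and a Lipschitz bound
off the diagonal are interpolated, and what remains is the integral of |x - y|^{-(1+α)}, uniformly
finite because 1 + α < 2 and surface balls have measure O(r²). The factor g(x) is itself α-Hölder,
so the gradient of the potential is too (`IsC1Holder.holderBound_gradPotential`).

The operators are therefore bounded to C^{1,α} already from C(Γ)
(`IsC1Holder.exists_clm_commPotential`). Compactness is the surplus: C^{0,α} embeds compactly into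
C(Γ) by Arzelà–Ascoli (`HolderC0.isCompactOperator_toContCLM`), and composition with bounded maps
preserves compactness. -/

/-! ### Interpolation and Hölder bounds on compact spaces -/

/-- If b is the smaller distance, the two hypotheses bound Δ by 2B/b times min(1, δ/b), and min(1,
t) ≤ t^α for 0 ≤ α ≤ 1. This turns size and Lipschitz estimates of a kernel into a Hölder estimate.
-/
theorem le_rpow_mul_of_le_inv_of_le_sq {α a b δ B Δ : ℝ} (hα0 : 0 ≤ α) (hα1 : α ≤ 1)
    (ha : 0 < a) (hb : 0 < b) (hδ : 0 ≤ δ) (hB : 0 ≤ B)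
    (h1 : Δ ≤ B * (a⁻¹ + b⁻¹)) (h2 : Δ ≤ B * δ * (a⁻¹ ^ 2 + b⁻¹ ^ 2)) :
    Δ ≤ 2 * B * δ ^ α * (a ^ (-(1 + α)) + b ^ (-(1 + α))) := by
  wlog hab : b ≤ a generalizing a b
  · have := this hb ha (by linarith) (by linarith) (le_of_not_ge hab)
    linarith
  have hba : a⁻¹ ≤ b⁻¹ := inv_anti₀ hb hab
  have hai : 0 < a⁻¹ := inv_pos.mpr ha
  have hbi : 0 < b⁻¹ := inv_pos.mpr hb
  have hpow : b ^ (-(1 + α)) = b⁻¹ * b⁻¹ ^ α := by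
    rw [Real.rpow_neg hb.le, ← Real.inv_rpow hb.le, Real.rpow_add hbi, Real.rpow_one]
  have ha' : 0 ≤ a ^ (-(1 + α)) := Real.rpow_nonneg ha.le _
  have hδα : 0 ≤ δ ^ α := Real.rpow_nonneg hδ _
  have key : Δ ≤ 2 * B * (b⁻¹ * (δ * b⁻¹) ^ α) := by
    rcases le_total (δ * b⁻¹) 1 with h | h
    · have h3 : δ * b⁻¹ ≤ (δ * b⁻¹) ^ α :=
        Real.self_le_rpow_of_le_one (by positivity) h hα1
      calc Δ ≤ B * δ * (a⁻¹ ^ 2 + b⁻¹ ^ 2) := h2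
        _ ≤ B * δ * (b⁻¹ ^ 2 + b⁻¹ ^ 2) := by gcongr
        _ = 2 * B * (b⁻¹ * (δ * b⁻¹)) := by ring
        _ ≤ _ := by gcongr
    · have h3 : 1 ≤ (δ * b⁻¹) ^ α := Real.one_le_rpow h hα0
      calc Δ ≤ B * (a⁻¹ + b⁻¹) := h1
        _ ≤ B * (b⁻¹ + b⁻¹) := by gcongr
        _ = 2 * B * (b⁻¹ * 1) := by ring
        _ ≤ _ := by gcongr
  calc Δ ≤ 2 * B * (b⁻¹ * (δ * b⁻¹) ^ α) := key
    _ = 2 * B * δ ^ α * (0 + b ^ (-(1 + α))) := by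
      rw [Real.mul_rpow hδ hbi.le, hpow]; ring
    _ ≤ _ := by gcongr

/-- A function on a compact metric space that is locally Hölder continuous is Hölder
continuous. -/
theorem exists_norm_sub_le_of_locally {X E : Type*} [MetricSpace X] [CompactSpace X]
    [NormedAddCommGroup E] {s : ℝ} (hs : 0 < s) {f : X → E}
    (h : ∀ p, ∃ U ∈ 𝓝 p, ∃ C : ℝ, ∀ x ∈ U, ∀ y ∈ U, ‖f x - f y‖ ≤ C * dist x y ^ s) :
    ∃ C : ℝ, 0 ≤ C ∧ ∀ x y, ‖f x - f y‖ ≤ C * dist x y ^ s := by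
  have hcont : Continuous f := by
    refine continuous_iff_continuousAt.mpr fun p => ?_
    obtain ⟨U, hU, C, hC⟩ := h p
    refine tendsto_iff_norm_sub_tendsto_zero.mpr ?_
    have h1 : Tendsto (fun x => C * dist x p ^ s) (𝓝 p) (𝓝 0) := by
      have h2 : ContinuousAt (fun x => C * dist x p ^ s) p :=
        continuousAt_const.mul ((continuous_id.dist continuous_const).continuousAt.rpow_const
          (Or.inr hs.le))
      have h3 := h2.tendsto
      simpa [Real.zero_rpow hs.ne'] using h3
    refine squeeze_zero' (Eventually.of_forall fun _ => norm_nonneg _) ?_ h1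
    filter_upwards [hU] with x hx
    exact hC x hx p (mem_of_mem_nhds hU)
  -- Compactness of X × X: near a diagonal point the hypothesis applies, and near any other point
  -- the distance stays away from zero.
  have key : ∃ C : ℝ, ∀ z ∈ (Set.univ : Set (X × X)), ‖f z.1 - f z.2‖ ≤ C * dist z.1 z.2 ^ s := by
    refine isCompact_univ.induction_on (p := fun S : Set (X × X) => ∃ C : ℝ, ∀ z ∈ S,
      ‖f z.1 - f z.2‖ ≤ C * dist z.1 z.2 ^ s) ⟨0, by simp⟩ ?_ ?_ ?_
    · rintro S T hST ⟨C, hC⟩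
      exact ⟨C, fun z hz => hC z (hST hz)⟩
    · rintro S T ⟨C, hC⟩ ⟨C', hC'⟩
      refine ⟨max C C', ?_⟩
      rintro z (hz | hz)
      · exact (hC z hz).trans (by gcongr; exact le_max_left _ _)
      · exact (hC' z hz).trans (by gcongr; exact le_max_right _ _)
    · rintro ⟨p, q⟩ -
      simp only [nhdsWithin_univ]
      by_cases hpq : p = q
      · subst hpq
        obtain ⟨U, hU, C, hC⟩ := h p
        exact ⟨U ×ˢ U, prod_mem_nhds hU hU, C, fun z hz => hC _ hz.1 _ hz.2⟩
      · have hd : 0 < dist p q ^ s := Real.rpow_pos_of_pos (dist_pos.mpr hpq) _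
        -- The constant makes the right side at (p, q) equal to ‖f p - f q‖ + 1 + dist p q ^ s. The
        -- inequality is strict there, so it persists nearby by continuity.
        have h1 : ContinuousAt (fun z : X × X =>
            ((‖f p - f q‖ + 1) / dist p q ^ s + 1) * dist z.1 z.2 ^ s) (p, q) :=
          continuousAt_const.mul (continuous_dist.continuousAt.rpow_const (Or.inr hs.le))
        have h2 : ContinuousAt (fun z : X × X => ‖f z.1 - f z.2‖) (p, q) := by
          fun_prop
        refine ⟨_, h2.eventually_lt h1 ?_, _, fun z hz => le_of_lt hz⟩
        simp only
        rw [add_mul, div_mul_cancel₀ _ hd.ne']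
        linarith
  obtain ⟨C, hC⟩ := key
  refine ⟨max C 0, le_max_right _ _, fun x y => (hC (x, y) trivial).trans ?_⟩
  gcongr
  exact le_max_left _ _

/-- `f` is bounded by `M` and Hölder continuous with exponent `s` and constant `M`. -/
structure HolderBound {X E : Type*} [MetricSpace X] [NormedAddCommGroup E] (s M : ℝ)
    (f : X → E) : Prop where
  bound : ∀ x, ‖f x‖ ≤ M
  diff : ∀ x y, ‖f x - f y‖ ≤ M * dist x y ^ s

namespace HolderBound

variable {X E : Type*} [MetricSpace X] [NormedAddCommGroup E] {s M N : ℝ}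

theorem mono {f : X → E} (hf : HolderBound s M f) (h : M ≤ N) : HolderBound s N f where
  bound x := (hf.bound x).trans h
  diff x y := (hf.diff x y).trans (by gcongr)

theorem add {f g : X → E} (hf : HolderBound s M f) (hg : HolderBound s N g) :
    HolderBound s (M + N) (fun x => f x + g x) where
  bound x := (norm_add_le _ _).trans (add_le_add (hf.bound x) (hg.bound x))
  diff x y := by
    rw [add_sub_add_comm, add_mul]
    exact (norm_add_le _ _).trans (add_le_add (hf.diff x y) (hg.diff x y))

theorem neg {f : X → E} (hf : HolderBound s M f) : HolderBound s M (fun x => -f x) where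
  bound x := by rw [norm_neg]; exact hf.bound x
  diff x y := by rw [← neg_sub', norm_neg]; exact hf.diff x y

theorem sub {f g : X → E} (hf : HolderBound s M f) (hg : HolderBound s N g) :
    HolderBound s (M + N) (fun x => f x - g x) := by
  simpa only [sub_eq_add_neg] using hf.add hg.neg

theorem sum {ι : Type*} (t : Finset ι) {f : ι → X → E} {M : ι → ℝ}
    (hf : ∀ i, HolderBound s (M i) (f i)) :
    HolderBound s (∑ i ∈ t, M i) (fun x => ∑ i ∈ t, f i x) where
  bound x := norm_sum_le_of_le _ fun i _ => (hf i).bound x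
  diff x y := by
    rw [← Finset.sum_sub_distrib, Finset.sum_mul]
    exact norm_sum_le_of_le _ fun i _ => (hf i).diff x y

theorem mul {R : Type*} [NormedRing R] {f g : X → R} (hM : 0 ≤ M) (hN : 0 ≤ N)
    (hf : HolderBound s M f) (hg : HolderBound s N g) :
    HolderBound s (2 * (M * N)) (fun x => f x * g x) where
  bound x := by
    have h := (norm_mul_le (f x) (g x)).trans
      (mul_le_mul (hf.bound x) (hg.bound x) (norm_nonneg _) hM)
    nlinarith [mul_nonneg hM hN]
  diff x y := by
    have h : f x * g x - f y * g y = (f x - f y) * g x + f y * (g x - g y) := by noncomm_ring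
    have hd : 0 ≤ dist x y ^ s := Real.rpow_nonneg dist_nonneg _
    calc ‖f x * g x - f y * g y‖ ≤ ‖f x - f y‖ * ‖g x‖ + ‖f y‖ * ‖g x - g y‖ := by
          rw [h]
          exact (norm_add_le _ _).trans (add_le_add (norm_mul_le _ _) (norm_mul_le _ _))
      _ ≤ (M * dist x y ^ s) * N + M * (N * dist x y ^ s) := by
          gcongr
          exacts [hf.diff x y, hg.bound x, hf.bound y, hg.diff x y]
      _ = _ := by ring

theorem holderWith {α : ℝ≥0} {M : ℝ≥0} {f : X → E} (hf : HolderBound α M f) :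
    HolderWith M α f := fun x y => by
  rw [edist_nndist, edist_nndist, ← ENNReal.coe_rpow_of_nonneg _ α.coe_nonneg, ← ENNReal.coe_mul,
    ENNReal.coe_le_coe, ← NNReal.coe_le_coe]
  simpa [dist_eq_norm] using hf.diff x y

end HolderBound

theorem exists_holderBound {X E : Type*} [MetricSpace X] [CompactSpace X]
    [NormedAddCommGroup E] {s : ℝ} (hs : 0 < s) {f : X → E}
    (h : ∀ p, ∃ U ∈ 𝓝 p, ∃ C : ℝ, ∀ x ∈ U, ∀ y ∈ U, ‖f x - f y‖ ≤ C * dist x y ^ s) :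
    ∃ M, 0 ≤ M ∧ HolderBound s M f := by
  obtain ⟨C, hC0, hC⟩ := exists_norm_sub_le_of_locally hs h
  have hcont : Continuous f := by
    lift s to ℝ≥0 using hs.le
    lift C to ℝ≥0 using hC0
    have : HolderWith C s f := fun x y => by
      rw [edist_nndist, edist_nndist, ← ENNReal.coe_rpow_of_nonneg _ s.coe_nonneg,
        ← ENNReal.coe_mul, ENNReal.coe_le_coe, ← NNReal.coe_le_coe]
      simpa [dist_eq_norm] using hC x y
    exact this.continuous (by exact_mod_cast hs)
  obtain ⟨B, hB⟩ := (isCompact_range hcont).isBounded.exists_norm_le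
  refine ⟨max B C, le_max_of_le_right hC0, fun x => ?_, fun x y => ?_⟩
  · exact (hB _ ⟨x, rfl⟩).trans (le_max_left _ _)
  · exact (hC x y).trans (by gcongr; exact le_max_right _ _)

/-! ### Riesz potentials under quadratic measure growth -/

/-- On a space with quadratic measure growth, the powers `dist ^ (-s)` with `s < 2` are
uniformly integrable. -/
theorem exists_lintegral_dist_rpow_le {X : Type*} [MetricSpace X] [MeasurableSpace X]
    [BorelSpace X] {μ : Measure X} [IsFiniteMeasure μ] {C : ℝ}
    (hμ : ∀ x r, 0 ≤ r → μ (Metric.closedBall x r) ≤ ENNReal.ofReal (C * r ^ 2))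
    {s : ℝ} (hs0 : 0 < s) (hs2 : s < 2) :
    ∃ A : ℝ, 0 ≤ A ∧ ∀ x, ∫⁻ y, ENNReal.ofReal (dist x y ^ (-s)) ∂μ ≤ ENNReal.ofReal A := by
  have hexp : -(2 / s) < -1 := by
    rw [neg_lt_neg_iff, lt_div_iff₀ hs0]; linarith
  have hint : IntegrableOn (fun t : ℝ => C * t ^ (-(2 / s))) (Set.Ioi 1) :=
    (integrableOn_Ioi_rpow_of_lt hexp zero_lt_one).const_mul C
  have hfin : μ Set.univ + ∫⁻ t in Set.Ioi (1 : ℝ), ENNReal.ofReal (C * t ^ (-(2 / s))) ≠ ∞ :=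
    ENNReal.add_ne_top.mpr ⟨measure_ne_top _ _, hint.lintegral_lt_top.ne⟩
  refine ⟨(μ Set.univ + ∫⁻ t in Set.Ioi (1 : ℝ), ENNReal.ofReal (C * t ^ (-(2 / s)))).toReal,
    ENNReal.toReal_nonneg, fun x => ?_⟩
  rw [ENNReal.ofReal_toReal hfin]
  -- Layer-cake formula. Levels t ≤ 1 cost at most the total mass; for t > 1 the superlevel set lies
  -- in the ball of radius t^(-1/s), of measure at most C t^(-2/s), which is integrable at infinity
  -- exactly because s < 2.
  rw [lintegral_eq_lintegral_meas_le μ (Eventually.of_forall fun y =>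
    Real.rpow_nonneg dist_nonneg _) (by fun_prop), ← Set.Ioc_union_Ioi_eq_Ioi zero_le_one,
    lintegral_union measurableSet_Ioi Set.Ioc_disjoint_Ioi_same]
  gcongr ?_ + ?_
  · refine (setLIntegral_mono measurable_const
      fun t _ => measure_mono (Set.subset_univ _)).trans ?_
    simp
  · refine setLIntegral_mono (by fun_prop) fun t (ht : 1 < t) => ?_
    have ht0 : 0 < t := by linarith
    refine (measure_mono fun y (hy : t ≤ dist x y ^ (-s)) => ?_).trans
      ((hμ x (t ^ (-(1 / s))) (by positivity)).trans_eq ?_)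
    · rw [Metric.mem_closedBall']
      -- The centre y = x is not in the superlevel set, since 0 ^ (-s) = 0 by convention and t > 1.
      have hd : 0 < dist x y := by
        rcases (dist_nonneg (x := x) (y := y)).eq_or_lt with h | h
        · rw [← h, Real.zero_rpow (by linarith)] at hy
          linarith
        · exact h
      have := Real.rpow_le_rpow_of_nonpos ht0 hy
        (show -(1 / s) ≤ 0 by rw [neg_nonpos]; positivity)
      rwa [← Real.rpow_mul hd.le, neg_mul_neg, mul_one_div_cancel hs0.ne', Real.rpow_one] at this
    · rw [← Real.rpow_natCast, ← Real.rpow_mul ht0.le]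
      congr 3
      push_cast
      ring

/-! ### Difference quotients -/

section DiffQuot

variable {X : Type*} [MetricSpace X]

/-- The reciprocal of the distance, as a complex number. -/
noncomputable def invDist (x y : X) : ℂ := ((dist x y)⁻¹ : ℝ)

/-- The difference quotient of a function. -/
noncomputable def diffQuot (q : X → ℂ) (x y : X) : ℂ := (q x - q y) * invDist x y

theorem norm_invDist (x y : X) : ‖invDist x y‖ = (dist x y)⁻¹ := by
  rw [invDist, Complex.norm_real, Real.norm_of_nonneg (inv_nonneg.mpr dist_nonneg)]

/-- The convention 0⁻¹ = 0 makes all kernels built from `invDist` vanish on the diagonal, so size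
bounds hold there without exception. -/
theorem invDist_self (x : X) : invDist x x = 0 := by simp [invDist]

theorem norm_invDist_sub_le {x x' y : X} (hx : x ≠ y) (hx' : x' ≠ y) :
    ‖invDist x y - invDist x' y‖ ≤ dist x x' * ((dist x y)⁻¹ * (dist x' y)⁻¹) := by
  have h1 := dist_pos.mpr hx
  have h2 := dist_pos.mpr hx'
  rw [invDist, invDist, ← Complex.ofReal_sub, Complex.norm_real, inv_sub_inv h1.ne' h2.ne',
    norm_div, norm_mul, Real.norm_of_nonneg h1.le, Real.norm_of_nonneg h2.le, div_eq_mul_inv,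
    mul_inv]
  gcongr
  rw [Real.norm_eq_abs, abs_sub_comm]
  exact abs_dist_sub_le x x' y

theorem norm_diffQuot_le {q : X → ℂ} {L : ℝ} (hL : 0 ≤ L)
    (hq : ∀ x y, ‖q x - q y‖ ≤ L * dist x y) (x y : X) : ‖diffQuot q x y‖ ≤ L := by
  rw [diffQuot, norm_mul, norm_invDist, ← div_eq_mul_inv]
  exact div_le_of_le_mul₀ dist_nonneg hL (hq x y)

/-- In the splitting below, the factor dist x' y from the Lipschitz bound cancels the singularity at
x'. Only the singularity seen from x survives, so the bound divided by dist x x' is a dominating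
function independent of x'. -/
theorem norm_diffQuot_sub_le {q : X → ℂ} {L : ℝ} (hL : 0 ≤ L)
    (hq : ∀ x y, ‖q x - q y‖ ≤ L * dist x y) {x y : X} (hx : x ≠ y) (x' : X) :
    ‖diffQuot q x y - diffQuot q x' y‖ ≤ 2 * L * dist x x' * (dist x y)⁻¹ := by
  have hpos := dist_pos.mpr hx
  rcases eq_or_ne x' y with rfl | hx'
  · have h0 : diffQuot q x' x' = 0 := by simp [diffQuot]
    rw [h0, sub_zero, mul_assoc, mul_inv_cancel₀ hpos.ne']
    linarith [norm_diffQuot_le hL hq x x']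
  · have hpos' := dist_pos.mpr hx'
    have h : diffQuot q x y - diffQuot q x' y =
        (q x - q x') * invDist x y + (q x' - q y) * (invDist x y - invDist x' y) := by
      simp only [diffQuot]; ring
    calc ‖diffQuot q x y - diffQuot q x' y‖
        ≤ ‖q x - q x'‖ * ‖invDist x y‖ + ‖q x' - q y‖ * ‖invDist x y - invDist x' y‖ := by
          rw [h, ← norm_mul, ← norm_mul]
          exact norm_add_le _ _
      _ ≤ L * dist x x' * (dist x y)⁻¹ +
          L * dist x' y * (dist x x' * ((dist x y)⁻¹ * (dist x' y)⁻¹)) := by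
          gcongr
          exacts [hq _ _, (norm_invDist x y).le, hq _ _, norm_invDist_sub_le hx hx']
      _ = _ := by field_simp; ring

end DiffQuot

/-! ### Weakly singular kernels -/

section WeaklySingularKernels

variable {X : Type*} [MetricSpace X] [MeasurableSpace X]

/-- The Riesz potentials of order `1` and `1 + α` of the measure `μ` are bounded by `A`. -/
structure RieszBound (μ : Measure X) (α A : ℝ) : Prop where
  nonneg : 0 ≤ A
  one : ∀ x, ∫⁻ y, ENNReal.ofReal (dist x y ^ (-1 : ℝ)) ∂μ ≤ ENNReal.ofReal A
  add : ∀ x, ∫⁻ y, ENNReal.ofReal (dist x y ^ (-(1 + α))) ∂μ ≤ ENNReal.ofReal A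

theorem integrable_and_integral_dist_rpow_le [BorelSpace X] {μ : Measure X} {s A : ℝ}
    (hA : 0 ≤ A) {x : X}
    (h : ∫⁻ y, ENNReal.ofReal (dist x y ^ s) ∂μ ≤ ENNReal.ofReal A) :
    Integrable (fun y => dist x y ^ s) μ ∧ ∫ y, dist x y ^ s ∂μ ≤ A := by
  have hnn : 0 ≤ᵐ[μ] fun y => dist x y ^ s :=
    Eventually.of_forall fun y => Real.rpow_nonneg dist_nonneg _
  have hm : AEStronglyMeasurable (fun y => dist x y ^ s) μ := by
    have : Measurable (fun y => dist x y ^ s) := by fun_prop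
    exact this.aestronglyMeasurable
  refine ⟨⟨hm, ?_⟩, ?_⟩
  · rw [hasFiniteIntegral_iff_ofReal hnn]
    exact h.trans_lt ENNReal.ofReal_lt_top
  · rw [integral_eq_lintegral_of_nonneg_ae hnn hm]
    exact ENNReal.toReal_le_of_le_ofReal hA h

/-- Weakly singular kernels, of order `-1` on a space of dimension two. -/
structure WeaklySingular (α B : ℝ) (h : X → X → ℂ) : Prop where
  meas : ∀ x, Measurable (h x)
  nonneg : 0 ≤ B
  bound : ∀ x y, ‖h x y‖ ≤ B * dist x y ^ (-1 : ℝ)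
  diff : ∀ x x' y, ‖h x y - h x' y‖ ≤
    B * dist x x' ^ α * (dist x y ^ (-(1 + α)) + dist x' y ^ (-(1 + α)))

namespace WeaklySingular

variable {α A B : ℝ} {h : X → X → ℂ} {μ : Measure X}

/-- Off the diagonal this is the interpolation `le_rpow_mul_of_le_inv_of_le_sq`. If one of the two
points equals y, its kernel value is 0 and the distance from the other point to y is dist x x', so
the size bound suffices. -/
theorem of_offDiag (hα0 : 0 ≤ α) (hα1 : α ≤ 1) (hB : 0 ≤ B) (hm : ∀ x, Measurable (h x))
    (hdiag : ∀ x, h x x = 0) (hbound : ∀ x y, ‖h x y‖ ≤ B * (dist x y)⁻¹)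
    (hdiff : ∀ x x' y, x ≠ y → x' ≠ y →
      ‖h x y - h x' y‖ ≤ B * dist x x' * ((dist x y)⁻¹ ^ 2 + (dist x' y)⁻¹ ^ 2)) :
    WeaklySingular α (2 * B) h where
  meas := hm
  nonneg := by positivity
  bound x y := by
    rw [Real.rpow_neg_one]
    refine (hbound x y).trans ?_
    gcongr
    linarith
  diff x x' y := by
    have hd : ∀ x y : X, x ≠ y →
        B * (dist x y)⁻¹ ≤ 2 * B * dist x y ^ α * (dist x y ^ (-(1 + α))) := fun x y hxy => by
      have hpos := dist_pos.mpr hxy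
      rw [mul_assoc, ← Real.rpow_add hpos]
      have : α + -(1 + α) = -1 := by ring
      rw [this, Real.rpow_neg_one]
      gcongr
      linarith
    -- A nonzero power of 0 is 0, so the coinciding point contributes nothing to the right side and
    -- the other term must carry the estimate.
    have h0 : dist y y ^ (-(1 + α)) = 0 := by
      rw [dist_self, Real.zero_rpow (by linarith)]
    rcases eq_or_ne x y with rfl | hx
    · rcases eq_or_ne x' x with rfl | hx'
      · rw [sub_self, norm_zero, h0]
        simp
      · rw [hdiag, zero_sub, norm_neg, h0, zero_add, dist_comm x x']
        exact (hbound _ _).trans (hd _ _ hx')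
    · rcases eq_or_ne x' y with rfl | hx'
      · rw [hdiag, sub_zero, h0, add_zero]
        exact (hbound _ _).trans (hd _ _ hx)
      · refine le_rpow_mul_of_le_inv_of_le_sq hα0 hα1 (dist_pos.mpr hx) (dist_pos.mpr hx')
          dist_nonneg hB ?_ (hdiff x x' y hx hx')
        rw [mul_add]
        exact (norm_sub_le _ _).trans (add_le_add (hbound _ _) (hbound _ _))

theorem integrable_mul [BorelSpace X] (hh : WeaklySingular α B h) (hμ : RieszBound μ α A)
    {ψ : X → ℂ} {M : ℝ} (hψ : AEStronglyMeasurable ψ μ) (hM : ∀ y, ‖ψ y‖ ≤ M) (x : X) :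
    Integrable (fun y => h x y * ψ y) μ := by
  refine (((integrable_and_integral_dist_rpow_le hμ.nonneg (hμ.one x)).1.const_mul B).mul_const
    M).mono' ((hh.meas x).aestronglyMeasurable.mul hψ) (Eventually.of_forall fun y => ?_)
  rw [norm_mul]
  have := Real.rpow_nonneg (dist_nonneg (x := x) (y := y)) (-1)
  exact mul_le_mul (hh.bound x y) (hM y) (norm_nonneg _) (mul_nonneg hh.nonneg this)

/-- A weakly singular integral operator maps bounded functions to Hölder continuous functions. -/
theorem holderBound [BorelSpace X] (hh : WeaklySingular α B h) (hμ : RieszBound μ α A)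
    {ψ : X → ℂ} {M : ℝ} (hψ : AEStronglyMeasurable ψ μ) (hM0 : 0 ≤ M) (hM : ∀ y, ‖ψ y‖ ≤ M) :
    HolderBound α (2 * B * A * M) (fun x => ∫ y, h x y * ψ y ∂μ) where
  bound x := by
    have hi := integrable_and_integral_dist_rpow_le hμ.nonneg (hμ.one x)
    have hB := hh.nonneg
    have hA := hμ.nonneg
    calc ‖∫ y, h x y * ψ y ∂μ‖ ≤ ∫ y, B * dist x y ^ (-1 : ℝ) * M ∂μ := by
          refine norm_integral_le_of_norm_le ((hi.1.const_mul B).mul_const M)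
            (Eventually.of_forall fun y => ?_)
          rw [norm_mul]
          have := Real.rpow_nonneg (dist_nonneg (x := x) (y := y)) (-1)
          exact mul_le_mul (hh.bound x y) (hM y) (norm_nonneg _) (by positivity)
      _ = B * (∫ y, dist x y ^ (-1 : ℝ) ∂μ) * M := by
          rw [integral_mul_const, integral_const_mul]
      _ ≤ B * A * M := by gcongr; exact hi.2
      _ ≤ 2 * B * A * M := by nlinarith [mul_nonneg (mul_nonneg hB hA) hM0]
  diff x x' := by
    have hi := integrable_and_integral_dist_rpow_le hμ.nonneg (hμ.add x)
    have hi' := integrable_and_integral_dist_rpow_le hμ.nonneg (hμ.add x')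
    have hB := hh.nonneg
    have hA := hμ.nonneg
    have hδ : 0 ≤ dist x x' ^ α := Real.rpow_nonneg dist_nonneg _
    rw [← integral_sub (hh.integrable_mul hμ hψ hM x) (hh.integrable_mul hμ hψ hM x')]
    calc ‖∫ y, (h x y * ψ y - h x' y * ψ y) ∂μ‖
        ≤ ∫ y, B * dist x x' ^ α * (dist x y ^ (-(1 + α)) + dist x' y ^ (-(1 + α))) * M ∂μ := by
          refine norm_integral_le_of_norm_le (((hi.1.add hi'.1).const_mul _).mul_const M)
            (Eventually.of_forall fun y => ?_)
          rw [← sub_mul, norm_mul]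
          have h1 := Real.rpow_nonneg (dist_nonneg (x := x) (y := y)) (-(1 + α))
          have h2 := Real.rpow_nonneg (dist_nonneg (x := x') (y := y)) (-(1 + α))
          exact mul_le_mul (hh.diff x x' y) (hM y) (norm_nonneg _) (by positivity)
      _ = B * dist x x' ^ α *
          (∫ y, dist x y ^ (-(1 + α)) ∂μ + ∫ y, dist x' y ^ (-(1 + α)) ∂μ) * M := by
          rw [integral_mul_const, integral_const_mul, integral_add hi.1 hi'.1]
      _ ≤ B * dist x x' ^ α * (A + A) * M := by
          gcongr
          exacts [hi.2, hi'.2]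
      _ = 2 * B * A * M * dist x x' ^ α := by ring

end WeaklySingular

theorem measurable_invDist [BorelSpace X] (x : X) : Measurable (invDist x) := by
  unfold invDist
  fun_prop

theorem measurable_diffQuot [BorelSpace X] {q : X → ℂ} (hq : Continuous q) (x : X) :
    Measurable (diffQuot q x) := by
  have := hq.measurable
  exact (measurable_const.sub this).mul (measurable_invDist x)

theorem weaklySingular_invDist [BorelSpace X] {α : ℝ} (hα0 : 0 ≤ α) (hα1 : α ≤ 1) :
    WeaklySingular α 2 (invDist : X → X → ℂ) := by
  have := WeaklySingular.of_offDiag (X := X) (h := invDist) hα0 hα1 zero_le_one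
    measurable_invDist invDist_self (fun x y => by rw [norm_invDist, one_mul]) ?_
  · simpa using this
  · intro x x' y hx hx'
    rw [one_mul]
    refine (norm_invDist_sub_le hx hx').trans ?_
    gcongr
    nlinarith [sq_nonneg ((dist x y)⁻¹ - (dist x' y)⁻¹), sq_nonneg (dist x y)⁻¹,
      sq_nonneg (dist x' y)⁻¹]

/-- Each quotient is bounded and changes by at most a multiple of dist x x' / dist x y; the last
factor has order -1. With p a coordinate function, this is the genuinely singular part of the
gradient of the commutator kernel. -/
theorem weaklySingular_diffQuot_mul [BorelSpace X] {α : ℝ} (hα0 : 0 ≤ α) (hα1 : α ≤ 1)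
    {q p : X → ℂ} {L N : ℝ} (hL : 0 ≤ L) (hN : 0 ≤ N) (hqc : Continuous q) (hpc : Continuous p)
    (hq : ∀ x y, ‖q x - q y‖ ≤ L * dist x y) (hp : ∀ x y, ‖p x - p y‖ ≤ N * dist x y) :
    WeaklySingular α (2 * (5 * (L * N)))
      (fun x y => diffQuot q x y * diffQuot p x y * invDist x y) := by
  have hLN := mul_nonneg hL hN
  refine WeaklySingular.of_offDiag hα0 hα1 (by positivity) (fun x => ?_) (fun x => ?_)
    (fun x y => ?_) fun x x' y hx hx' => ?_
  · exact ((measurable_diffQuot hqc x).mul (measurable_diffQuot hpc x)).mul (measurable_invDist x)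
  · rw [invDist_self, mul_zero]
  · rw [norm_mul, norm_mul, norm_invDist]
    refine mul_le_mul_of_nonneg_right ?_ (inv_nonneg.mpr dist_nonneg)
    have := mul_le_mul (norm_diffQuot_le hL hq x y) (norm_diffQuot_le hN hp x y)
      (norm_nonneg _) hL
    linarith
  · set a := (dist x y)⁻¹ with ha
    set b := (dist x' y)⁻¹ with hb
    have ha0 : 0 ≤ a := inv_nonneg.mpr dist_nonneg
    have hb0 : 0 ≤ b := inv_nonneg.mpr dist_nonneg
    have hδ : 0 ≤ dist x x' := dist_nonneg
    -- Telescoping, one factor at a time. The first two terms give 2a² each and the last gives ab,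
    -- whence the constant 5 in front of a² + b².
    have h : diffQuot q x y * diffQuot p x y * invDist x y -
        diffQuot q x' y * diffQuot p x' y * invDist x' y =
        (diffQuot q x y - diffQuot q x' y) * diffQuot p x y * invDist x y +
        diffQuot q x' y * (diffQuot p x y - diffQuot p x' y) * invDist x y +
        diffQuot q x' y * diffQuot p x' y * (invDist x y - invDist x' y) := by ring
    calc ‖diffQuot q x y * diffQuot p x y * invDist x y -
        diffQuot q x' y * diffQuot p x' y * invDist x' y‖
        ≤ (2 * L * dist x x' * a) * N * a + L * (2 * N * dist x x' * a) * a +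
          L * N * (dist x x' * (a * b)) := by
          rw [h]
          refine (norm_add₃_le).trans ?_
          simp only [norm_mul]
          gcongr
          exacts [norm_diffQuot_sub_le hL hq hx x', norm_diffQuot_le hN hp _ _,
            (norm_invDist _ _).le, norm_diffQuot_le hL hq _ _, norm_diffQuot_sub_le hN hp hx x',
            (norm_invDist _ _).le, norm_diffQuot_le hL hq _ _, norm_diffQuot_le hN hp _ _,
            norm_invDist_sub_le hx hx']
      _ = L * N * dist x x' * (4 * a ^ 2 + a * b) := by ring
      _ ≤ L * N * dist x x' * (5 * (a ^ 2 + b ^ 2)) := by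
          gcongr
          nlinarith [sq_nonneg (a - b), sq_nonneg a, sq_nonneg b]
      _ = _ := by ring

end WeaklySingularKernels

/-! ### The outward normal in a graph chart -/

namespace HolderDomain

variable {α : ℝ≥0} (D : HolderDomain α)

/-- The outward unit normal in a chart in which the boundary is the graph of `f`. -/
theorem isOutwardUnitNormal_of_graph {e : E3 ≃ᵃⁱ[ℝ] WithLp 2 (E2 × ℝ)} {f : E2 → ℝ} {W : Set E3}
    (hf2 : ContDiff ℝ 2 f) (hW : IsOpen W)
    (h : ∀ y ∈ W, (y ∈ D.carrier ↔ (e y).snd < f (e y).fst)) (x : D.Γ) (hxW : (x : E3) ∈ W)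
    {m : E3} (hm : m = e.linearIsometryEquiv.symm (WithLp.toLp 2
      (-(InnerProductSpace.toDual ℝ E2).symm (fderiv ℝ f (e x).fst), (1 : ℝ)))) :
    m ≠ 0 ∧ IsOutwardUnitNormal D.carrier x (‖m‖⁻¹ • m) := by
  have hf : Continuous f := hf2.continuous
  let A := e.linearIsometryEquiv
  set a : E2 := (e x).fst with ha
  have hfd : HasFDerivAt f (fderiv ℝ f a) a :=
    (hf2.differentiable (by norm_num)).differentiableAt.hasFDerivAt
  have hxf : (e x).snd = f a := (D.mem_frontier_of_graph hf hW h hxW).1.mp x.2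
  have heA : ∀ v : E3, e (v +ᵥ (x : E3)) = A v + e x := fun v =>
    e.map_vadd (x : E3) v
  obtain ⟨G, hG, hGdef⟩ : ∃ G : E2, (∀ w, fderiv ℝ f a w = inner ℝ G w) ∧
      (InnerProductSpace.toDual ℝ E2).symm (fderiv ℝ f a) = G :=
    ⟨_, fun w => by simp, rfl⟩
  rw [hGdef] at hm
  have hAm : A m = WithLp.toLp 2 (-G, 1) := by 
    rw [hm]; exact A.apply_symm_apply _
  have hm0 : m ≠ 0 := by
    intro h0
    rw [h0, map_zero] at hAm
    have := congrArg WithLp.snd hAm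
    simp at this
  have hmpos : 0 < ‖m‖ := norm_pos_iff.mpr hm0
  -- the height of `x + t m` above the graph
  let d : ℝ → ℝ := fun t => (f a + t) - f (a - t • G)
  -- The positive derivative says that the line along (-∇f, 1) crosses the graph transversally: d
  -- has the sign of t for small t, which decides the inner and outer sides.
  have hd : HasDerivAt d (1 + ‖G‖ ^ 2) 0 := by
    have h1 : HasDerivAt (fun t : ℝ => a - t • G) (-G) 0 := by
      simpa using ((hasDerivAt_id (0 : ℝ)).smul_const G).const_sub a
    have h2 : HasDerivAt (fun t : ℝ => f (a - t • G)) (fderiv ℝ f a (-G)) 0 := by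
      refine HasFDerivAt.comp_hasDerivAt (0 : ℝ) ?_ h1
      simpa using hfd
    have h3 := ((hasDerivAt_id (0 : ℝ)).const_add (f a)).sub h2
    have e1 : (1 : ℝ) - fderiv ℝ f a (-G) = 1 + ‖G‖ ^ 2 := by
      rw [hG, inner_neg_right, real_inner_self_eq_norm_sq]; ring
    rw [e1] at h3
    exact h3
  have hd0 : d 0 = 0 := by simp [d]
  have hslope : ∀ᶠ t in 𝓝[≠] (0 : ℝ), 0 < slope d 0 t :=
    (hasDerivAt_iff_tendsto_slope.mp hd).eventually (lt_mem_nhds (by positivity))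
  have hcurve : ∀ t : ℝ, e ((x : E3) + t • m) = WithLp.toLp 2 (a - t • G, f a + t) := by
    intro t
    have : (x : E3) + t • m = (t • m) +ᵥ (x : E3) := by simp [add_comm]
    rw [this, heA, map_smul, hAm]
    refine WithLp.ofLp_injective 2 (Prod.ext ?_ ?_)
    · simp [← ha]; abel
    · simp [hxf, add_comm]
  have hWm : ∀ᶠ t in 𝓝 (0 : ℝ), (x : E3) + t • m ∈ W := by
    have : Continuous fun t : ℝ => (x : E3) + t • m := by fun_prop
    refine this.continuousAt.preimage_mem_nhds ?_
    simpa using hW.mem_nhds hxW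
  have hout : ∀ᶠ t in 𝓝[>] (0 : ℝ), (x : E3) + t • m ∉ closure D.carrier := by
    have h1 : ∀ᶠ t in 𝓝[>] (0 : ℝ), 0 < slope d 0 t :=
      hslope.filter_mono (nhdsWithin_mono _ (fun t (ht : (0 : ℝ) < t) => ht.ne'))
    filter_upwards [h1, nhdsWithin_le_nhds hWm, self_mem_nhdsWithin] with t ht htW ht0 hc
    have ht0 : (0 : ℝ) < t := ht0
    have h2 := (D.mem_frontier_of_graph hf hW h htW).2 hc
    rw [hcurve] at h2
    have h3 : d t ≤ 0 := by simpa [d] using h2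
    rw [slope_def_field, hd0, sub_zero, sub_zero] at ht
    have := (div_pos_iff_of_pos_right ht0).mp ht
    linarith
  have hin : ∀ᶠ t in 𝓝[<] (0 : ℝ), (x : E3) + t • m ∈ D.carrier := by
    have h1 : ∀ᶠ t in 𝓝[<] (0 : ℝ), 0 < slope d 0 t :=
      hslope.filter_mono (nhdsWithin_mono _ (fun t (ht : t < (0 : ℝ)) => ht.ne))
    filter_upwards [h1, nhdsWithin_le_nhds hWm, self_mem_nhdsWithin] with t ht htW ht0
    have ht0 : t < (0 : ℝ) := ht0
    rw [h _ htW, hcurve]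
    rw [slope_def_field, hd0, sub_zero, sub_zero] at ht
    have h3 : d t < 0 := by
      by_contra h4
      push Not at h4
      exact absurd ht (not_lt.mpr (div_nonpos_of_nonneg_of_nonpos h4 ht0.le))
    have h5 : f a + t - f (a - t • G) < 0 := h3
    have h6 : f a + t < f (a - t • G) := by linarith
    exact h6
  refine ⟨hm0, ?_, ?_, ?_⟩
  · rw [norm_smul, norm_inv, norm_norm, inv_mul_cancel₀ hmpos.ne']
  · have hm : (fun y : E3 => inner ℝ m (y - x)) =o[𝓝[frontier D.carrier] (x : E3)]
        (fun y : E3 => y - x) := by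
      have ht : Tendsto (fun y : E3 => (e y).fst) (𝓝[frontier D.carrier] (x : E3)) (𝓝 a) :=
        ((((WithLp.prod_continuous_ofLp 2 E2 ℝ).comp e.continuous).fst).tendsto
          (x : E3)).mono_left nhdsWithin_le_nhds
      have h1 := hfd.isLittleO.comp_tendsto ht
      have h2 : (fun y : E3 => (e y).fst - a) =O[𝓝[frontier D.carrier] (x : E3)]
          (fun y : E3 => y - x) := by
        refine IsBigO.of_bound 1 (Eventually.of_forall fun y => ?_)
        have h3 : ‖e y - e x‖ = ‖y - x‖ := by
          rw [← dist_eq_norm, ← dist_eq_norm, e.dist_map]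
        rw [one_mul, ← h3]
        have := WithLp.prod_norm_sq_eq_of_L2 (e y - e x)
        have h4 : ‖(e y).fst - a‖ = ‖(e y - e x).fst‖ := by simp [ha]
        rw [h4]
        refine (sq_le_sq₀ (norm_nonneg _) (norm_nonneg _)).mp ?_
        nlinarith [sq_nonneg ‖(e y - e x).snd‖]
      refine (h1.trans_isBigO h2).congr' ?_ EventuallyEq.rfl
      filter_upwards [self_mem_nhdsWithin, nhdsWithin_le_nhds (hW.mem_nhds hxW)] with y hy hyW
      have hyf := (D.mem_frontier_of_graph hf hW h hyW).1.mp hy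
      have h5 : A (y - x) = e y - e x := by
        have := e.map_vsub y (x : E3)
        simpa [A] using this
      have h6 : inner ℝ m (y - x) = inner ℝ (A m) (A (y - x)) := (A.inner_map_map _ _).symm
      rw [h6, hAm, h5, WithLp.prod_inner_apply]
      simp only [Function.comp_apply, WithLp.ofLp_sub, Prod.fst_sub, Prod.snd_sub]
      have h7 : inner ℝ (1 : ℝ) ((e y).snd - (e x).snd) = (e y).snd - (e x).snd := by simp
      have h8 : inner ℝ (-G) ((e y).fst - a) = - fderiv ℝ f a ((e y).fst - a) := by
        rw [hG, inner_neg_left]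
      change _ = inner ℝ (-G) ((e y).fst - a) + inner ℝ (1 : ℝ) ((e y).snd - (e x).snd)
      rw [h7, h8, hyf, hxf]
      ring
    refine (hm.const_mul_left ‖m‖⁻¹).congr_left fun y => ?_
    rw [real_inner_smul_left]
  · have hpos : 0 < ‖m‖⁻¹ := inv_pos.mpr hmpos
    have hs1 : Tendsto (fun t : ℝ => t * ‖m‖⁻¹) (𝓝[>] 0) (𝓝[>] 0) := by
      refine tendsto_nhdsWithin_iff.mpr ⟨?_, ?_⟩
      · have : Continuous fun t : ℝ => t * ‖m‖⁻¹ := by fun_prop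
        simpa using (this.tendsto 0).mono_left nhdsWithin_le_nhds
      · filter_upwards [self_mem_nhdsWithin] with t ht
        exact mul_pos ht hpos
    have hs2 : Tendsto (fun t : ℝ => -(t * ‖m‖⁻¹)) (𝓝[>] 0) (𝓝[<] 0) := by
      refine tendsto_nhdsWithin_iff.mpr ⟨?_, ?_⟩
      · have : Continuous fun t : ℝ => -(t * ‖m‖⁻¹) := by fun_prop
        simpa using (this.tendsto 0).mono_left nhdsWithin_le_nhds
      · filter_upwards [self_mem_nhdsWithin] with t ht
        exact neg_neg_of_pos (mul_pos ht hpos)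
    filter_upwards [hs1.eventually hout, hs2.eventually hin] with t h1 h2
    rw [smul_smul]
    exact ⟨h1, by rwa [neg_smul, ← sub_eq_add_neg] at h2⟩

end HolderDomain

/-! ### Growth of the surface measure -/

namespace HolderDomain

variable {α : ℝ≥0} (D : HolderDomain α)

/-- A parametrization of the boundary by a chart: `F` is a local inverse of the `1`-Lipschitz
projection `π` on the boundary. -/
theorem exists_parametrization (p : D.Γ) : ∃ (π : E3 → E2) (F : E2 → E3) (U : Set D.Γ)
    (K : ℝ≥0) (t : Set E2), (∀ x y, dist (π x) (π y) ≤ dist x y) ∧ U ∈ 𝓝 p ∧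
      LipschitzOnWith K F t ∧ ∀ y ∈ U, π y ∈ t ∧ F (π y) = y := by
  obtain ⟨e, f, W, hf2, -, hW, hpW, h⟩ := D.local_graph p p.2
  have he : Continuous fun z : E3 => (e z).fst :=
    ((WithLp.prod_continuous_ofLp 2 E2 ℝ).comp e.continuous).fst
  let F : E2 → E3 := fun u => e.symm (WithLp.toLp 2 (u, f u))
  have hF : ContDiff ℝ 1 F := by
    have h1 : ContDiff ℝ 1 (e.symm : WithLp 2 (E2 × ℝ) → E3) :=
      ContinuousAffineMap.contDiff (e.symm.toContinuousAffineEquiv.toContinuousAffineMap)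
    have h2 : ContDiff ℝ 1 fun u : E2 => (u, f u) :=
      contDiff_id.prodMk (hf2.of_le (by norm_num))
    exact h1.comp ((WithLp.prodContinuousLinearEquiv 2 ℝ E2 ℝ).symm.contDiff.comp h2)
  obtain ⟨K, t, ht, hK⟩ := hF.contDiffAt.exists_lipschitzOnWith (x := (e p).fst)
  refine ⟨fun z => (e z).fst, F, {y | (y : E3) ∈ W ∧ (e y).fst ∈ t}, K, t, fun x y => ?_, ?_,
    hK, ?_⟩
  · rw [← e.dist_map x y, dist_eq_norm, dist_eq_norm]
    have := WithLp.prod_norm_sq_eq_of_L2 (e x - e y)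
    refine (sq_le_sq₀ (norm_nonneg _) (norm_nonneg _)).mp ?_
    rw [this]
    exact le_add_of_nonneg_right (sq_nonneg _)
  · have hc : Continuous fun y : D.Γ => (e (y : E3)).fst := he.comp continuous_subtype_val
    exact inter_mem (continuous_subtype_val.continuousAt.preimage_mem_nhds (hW.mem_nhds hpW))
      (hc.continuousAt.preimage_mem_nhds ht)
  · rintro y ⟨hyW, hyt⟩
    refine ⟨hyt, ?_⟩
    have h1 := (D.mem_frontier_of_graph hf2.continuous hW h hyW).1.mp y.2
    change e.symm (WithLp.toLp 2 ((e y).fst, f (e y).fst)) = y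
    rw [← h1]
    exact e.symm_apply_apply _

/-- The projection to the plane is 1-Lipschitz, so the set is the image under F of part of a disc of
radius r, and a K-Lipschitz map enlarges two-dimensional Hausdorff measure by at most K². The centre
x need not lie in U, so the bounds for different U can be added when Γ is covered. -/
theorem exists_nhds_surfaceMeasure_le (p : D.Γ) : ∃ U ∈ 𝓝 p, ∃ C : ℝ, 0 ≤ C ∧
    ∀ (x : D.Γ) (r : ℝ), 0 ≤ r →
      D.surfaceMeasure (Metric.closedBall x r ∩ U) ≤ ENNReal.ofReal (C * r ^ 2) := by
  obtain ⟨π, F, U, K, t, hπ, hU, hF, hUt⟩ := D.exists_parametrization p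
  set V : ℝ≥0∞ := volume (Metric.closedBall (0 : E2) 1) with hV
  have hVtop : V ≠ ∞ := measure_closedBall_lt_top.ne
  refine ⟨U, hU, (K : ℝ) ^ 2 * V.toReal, by positivity, fun x r hr => ?_⟩
  set T : Set E2 := t ∩ Metric.closedBall (π x) r
  have hsub : (Subtype.val '' (Metric.closedBall x r ∩ U) : Set E3) ⊆ F '' T := by
    rintro _ ⟨y, ⟨hy, hyU⟩, rfl⟩
    exact ⟨π y, ⟨(hUt y hyU).1, (hπ _ _).trans hy⟩, (hUt y hyU).2⟩
  -- The normalization of `μHE[2]` depends only on the dimension 2, so the same factor appears in E3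
  -- and in E2.
  have hμ : (μHE[2] : Measure E3) (F '' T) ≤ (K : ℝ≥0∞) ^ (2 : ℝ) * (μHE[2] : Measure E2) T := by
    simp only [Measure.euclideanHausdorffMeasure_def, Measure.smul_apply, ENNReal.smul_def,
      smul_eq_mul]
    rw [mul_left_comm]
    gcongr
    exact (hF.mono Set.inter_subset_left).hausdorffMeasure_image_le (by norm_num)
  calc D.surfaceMeasure (Metric.closedBall x r ∩ U)
      = (μHE[2] : Measure E3) (Subtype.val '' (Metric.closedBall x r ∩ U)) :=
        (isometry_subtype_coe.euclideanHausdorffMeasure_image _).symm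
    _ ≤ (K : ℝ≥0∞) ^ (2 : ℝ) * (μHE[2] : Measure E2) T := (measure_mono hsub).trans hμ
    _ ≤ (K : ℝ≥0∞) ^ (2 : ℝ) * (ENNReal.ofReal (r ^ 2) * V) := by
        rw [EuclideanSpace.euclideanHausdorffMeasure_eq_volume]
        gcongr
        refine (measure_mono Set.inter_subset_right).trans_eq ?_
        rw [Measure.addHaar_closedBall' _ _ hr]
        simp [hV]
    _ = ENNReal.ofReal ((K : ℝ) ^ 2 * V.toReal * r ^ 2) := by
        rw [ENNReal.ofReal_mul (by positivity), ENNReal.ofReal_mul (by positivity),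
          ENNReal.ofReal_toReal hVtop, ENNReal.ofReal_pow K.coe_nonneg,
          ENNReal.ofReal_coe_nnreal, ENNReal.rpow_ofNat]
        ring

/-- The surface measure has quadratic growth. -/
theorem exists_surfaceMeasure_closedBall_le : ∃ C : ℝ, 0 ≤ C ∧ ∀ (x : D.Γ) (r : ℝ), 0 ≤ r →
    D.surfaceMeasure (Metric.closedBall x r) ≤ ENNReal.ofReal (C * r ^ 2) := by
  have key : ∃ C : ℝ, 0 ≤ C ∧ ∀ (x : D.Γ) (r : ℝ), 0 ≤ r →
      D.surfaceMeasure (Metric.closedBall x r ∩ Set.univ) ≤ ENNReal.ofReal (C * r ^ 2) := by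
    refine isCompact_univ.induction_on (p := fun S : Set D.Γ => ∃ C : ℝ, 0 ≤ C ∧
      ∀ (x : D.Γ) (r : ℝ), 0 ≤ r →
        D.surfaceMeasure (Metric.closedBall x r ∩ S) ≤ ENNReal.ofReal (C * r ^ 2))
      ⟨0, le_rfl, by simp⟩ ?_ ?_ ?_
    · rintro S T hST ⟨C, hC0, hC⟩
      exact ⟨C, hC0, fun x r hr =>
        (measure_mono (Set.inter_subset_inter_right _ hST)).trans (hC x r hr)⟩
    · rintro S T ⟨C, hC0, hC⟩ ⟨C', hC0', hC'⟩
      refine ⟨C + C', add_nonneg hC0 hC0', fun x r hr => ?_⟩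
      rw [Set.inter_union_distrib_left, add_mul,
        ENNReal.ofReal_add (by positivity) (by positivity)]
      exact (measure_union_le _ _).trans (add_le_add (hC x r hr) (hC' x r hr))
    · intro p _
      rw [nhdsWithin_univ]
      exact D.exists_nhds_surfaceMeasure_le p
  simpa only [Set.inter_univ] using key

instance : IsFiniteMeasure D.surfaceMeasure := by
  refine ⟨?_⟩
  obtain ⟨C, -, hC⟩ := D.exists_surfaceMeasure_closedBall_le
  rcases isEmpty_or_nonempty D.Γ with h | ⟨⟨x⟩⟩
  · rw [Set.univ_eq_empty_iff.mpr h, measure_empty]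
    exact ENNReal.zero_lt_top
  · have hx : (Set.univ : Set D.Γ) ⊆ Metric.closedBall x (Metric.diam (Set.univ : Set D.Γ)) :=
      fun y _ => Metric.dist_le_diam_of_mem isCompact_univ.isBounded trivial trivial
    exact (measure_mono hx).trans_lt ((hC x _ Metric.diam_nonneg).trans_lt ENNReal.ofReal_lt_top)

/-- A ball of radius 0. It makes the diagonal y = x negligible in the differentiation under the
integral. -/
theorem surfaceMeasure_singleton (x : D.Γ) : D.surfaceMeasure {x} = 0 := by
  obtain ⟨C, -, hC⟩ := D.exists_surfaceMeasure_closedBall_le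
  simpa using hC x 0 le_rfl

theorem exists_rieszBound {s : ℝ} (hs0 : 0 < s) (hs1 : s < 1) :
    ∃ A, RieszBound D.surfaceMeasure s A := by
  obtain ⟨C, -, hC⟩ := D.exists_surfaceMeasure_closedBall_le
  obtain ⟨A, hA0, hA⟩ := exists_lintegral_dist_rpow_le hC one_pos one_lt_two
  obtain ⟨A', -, hA'⟩ := exists_lintegral_dist_rpow_le hC (s := 1 + s) (by linarith) (by linarith)
  exact ⟨max A A', le_max_of_le_left hA0,
    fun x => (hA x).trans (ENNReal.ofReal_le_ofReal (le_max_left _ _)),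
    fun x => (hA' x).trans (ENNReal.ofReal_le_ofReal (le_max_right _ _))⟩

end HolderDomain

/-! ### Local Hölder calculus and C^{1,α} maps -/

/-- `f` is Hölder continuous with exponent `s` in a neighbourhood of `p`. -/
def LocHolderAt {X E : Type*} [MetricSpace X] [NormedAddCommGroup E] (s : ℝ) (f : X → E)
    (p : X) : Prop :=
  ∃ U ∈ 𝓝 p, ∃ C : ℝ, ∀ x ∈ U, ∀ y ∈ U, ‖f x - f y‖ ≤ C * dist x y ^ s

namespace LocHolderAt

variable {X : Type*} [MetricSpace X] {s : ℝ} {p : X}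
variable {E F G : Type*} [NormedAddCommGroup E] [NormedSpace ℝ E] [NormedAddCommGroup F]
  [NormedSpace ℝ F] [NormedAddCommGroup G] [NormedSpace ℝ G]

theorem congr {E : Type*} [NormedAddCommGroup E] {f g : X → E} (hf : LocHolderAt s f p)
    (h : g =ᶠ[𝓝 p] f) : LocHolderAt s g p := by
  obtain ⟨U, hU, C, hC⟩ := hf
  refine ⟨U ∩ {x | g x = f x}, inter_mem hU h, C, ?_⟩
  rintro x ⟨hx, hx'⟩ y ⟨hy, hy'⟩
  rw [hx', hy']
  exact hC x hx y hy

theorem comp_lipschitz {Y E : Type*} [MetricSpace Y] [NormedAddCommGroup E] (hs : 0 ≤ s)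
    {f : X → E} {g : Y → X} {K : ℝ≥0} (hg : LipschitzWith K g) {q : Y}
    (hf : LocHolderAt s f (g q)) : LocHolderAt s (f ∘ g) q := by
  obtain ⟨U, hU, C, hC⟩ := hf
  refine ⟨g ⁻¹' U, hg.continuous.continuousAt.preimage_mem_nhds hU, max C 0 * (K : ℝ) ^ s,
    fun x hx y hy => (hC _ hx _ hy).trans ?_⟩
  rw [mul_assoc, ← Real.mul_rpow K.coe_nonneg dist_nonneg]
  gcongr
  exacts [le_max_left _ _, hg.dist_le_mul x y]

theorem of_lipschitzOnWith {E : Type*} [NormedAddCommGroup E] (hs1 : s ≤ 1)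
    {f : X → E} {K : ℝ≥0} {U : Set X} (hU : U ∈ 𝓝 p) (hf : LipschitzOnWith K f U) :
    LocHolderAt s f p := by
  -- Radius 1/2 keeps mutual distances at most 1, where d ≤ d ^ s for s ≤ 1.
  refine ⟨U ∩ Metric.ball p (1 / 2), inter_mem hU (Metric.ball_mem_nhds p (by norm_num)), K, ?_⟩
  rintro x ⟨hx, hx'⟩ y ⟨hy, hy'⟩
  have hd : dist x y ≤ 1 := by
    have := dist_triangle_right x y p
    rw [Metric.mem_ball] at hx' hy'
    linarith
  rw [← dist_eq_norm]
  refine (hf.dist_le_mul x hx y hy).trans ?_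
  gcongr
  rcases (dist_nonneg (x := x) (y := y)).eq_or_lt with h | h
  · rw [← h]
    exact Real.rpow_nonneg le_rfl _
  · simpa using Real.rpow_le_rpow_of_exponent_ge h hd hs1

theorem of_contDiffAt (hs1 : s ≤ 1) {f : F → E} {p : F} (hf : ContDiffAt ℝ 1 f p) :
    LocHolderAt s f p := by
  obtain ⟨K, t, ht, hK⟩ := hf.exists_lipschitzOnWith
  exact of_lipschitzOnWith hs1 ht hK

theorem of_memHolder {E : Type*} [NormedAddCommGroup E] {α : ℝ≥0} {f : X → E}
    (hf : MemHolder α f) : LocHolderAt (α : ℝ) f p := by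
  obtain ⟨C, hC⟩ := hf
  refine ⟨Set.univ, univ_mem, C, fun x _ y _ => ?_⟩
  have := hC x y
  rw [edist_nndist, edist_nndist, ← ENNReal.coe_rpow_of_nonneg _ α.coe_nonneg, ← ENNReal.coe_mul,
    ENNReal.coe_le_coe, ← NNReal.coe_le_coe] at this
  simpa [dist_eq_norm] using this

theorem norm_le_of_diff {E : Type*} [NormedAddCommGroup E] (hs : 0 ≤ s) {f : X → E} {U : Set X}
    {C : ℝ} (hU : U ∈ 𝓝 p) (hC : ∀ x ∈ U, ∀ y ∈ U, ‖f x - f y‖ ≤ C * dist x y ^ s) :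
    ∀ x ∈ U ∩ Metric.ball p 1, ‖f x‖ ≤ ‖f p‖ + |C| := by
  rintro x ⟨hx, hx'⟩
  have h1 := hC x hx p (mem_of_mem_nhds hU)
  have h2 : dist x p ^ s ≤ 1 := Real.rpow_le_one dist_nonneg (le_of_lt hx') hs
  have h3 : C * dist x p ^ s ≤ |C| * 1 :=
    mul_le_mul (le_abs_self C) h2 (Real.rpow_nonneg dist_nonneg _) (abs_nonneg C)
  have h4 := norm_le_norm_add_norm_sub' (f x) (f p)
  linarith

theorem bilin (hs : 0 ≤ s) (B : E →L[ℝ] F →L[ℝ] G) {f : X → E} {g : X → F}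
    (hf : LocHolderAt s f p) (hg : LocHolderAt s g p) :
    LocHolderAt s (fun x => B (f x) (g x)) p := by
  obtain ⟨U, hU, C, hC⟩ := hf
  obtain ⟨V, hV, C', hC'⟩ := hg
  refine ⟨(U ∩ Metric.ball p 1) ∩ (V ∩ Metric.ball p 1),
    inter_mem (inter_mem hU (Metric.ball_mem_nhds p one_pos))
      (inter_mem hV (Metric.ball_mem_nhds p one_pos)),
    ‖B‖ * (‖f p‖ + |C|) * C' + ‖B‖ * C * (‖g p‖ + |C'|), ?_⟩
  rintro x ⟨hx, hx'⟩ y ⟨hy, hy'⟩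
  have h : B (f x) (g x) - B (f y) (g y) = B (f x) (g x - g y) + B (f x - f y) (g y) := by
    simp
  have e1 := norm_le_of_diff hs hU hC x hx
  have e2 := norm_le_of_diff hs hV hC' y hy'
  have e3 := hC x hx.1 y hy.1
  have e4 := hC' x hx'.1 y hy'.1
  calc ‖B (f x) (g x) - B (f y) (g y)‖
      ≤ ‖B‖ * ‖f x‖ * ‖g x - g y‖ + ‖B‖ * ‖f x - f y‖ * ‖g y‖ := by
        rw [h]
        exact (norm_add_le _ _).trans (add_le_add (B.le_opNorm₂ _ _) (B.le_opNorm₂ _ _))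
    _ ≤ ‖B‖ * (‖f p‖ + |C|) * (C' * dist x y ^ s) +
        ‖B‖ * (C * dist x y ^ s) * (‖g p‖ + |C'|) := by
        have := (norm_nonneg _).trans e3
        gcongr
    _ = _ := by ring

theorem clm_apply (B : E →L[ℝ] F) {f : X → E} (hf : LocHolderAt s f p) :
    LocHolderAt s (fun x => B (f x)) p := by
  obtain ⟨U, hU, C, hC⟩ := hf
  refine ⟨U, hU, ‖B‖ * C, fun x hx y hy => ?_⟩
  rw [← map_sub, mul_assoc]
  exact (B.le_opNorm _).trans (by gcongr; exact hC x hx y hy)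

theorem sub {E : Type*} [NormedAddCommGroup E] {f g : X → E} (hf : LocHolderAt s f p)
    (hg : LocHolderAt s g p) : LocHolderAt s (fun x => f x - g x) p := by
  obtain ⟨U, hU, C, hC⟩ := hf
  obtain ⟨V, hV, C', hC'⟩ := hg
  refine ⟨U ∩ V, inter_mem hU hV, C + C', ?_⟩
  rintro x ⟨hx, hx'⟩ y ⟨hy, hy'⟩
  rw [sub_sub_sub_comm, add_mul]
  exact (norm_sub_le _ _).trans (add_le_add (hC x hx y hy) (hC' x hx' y hy'))

end LocHolderAt

/-- Functions that are continuously differentiable near `p`, with a derivative that is Hölder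
continuous near `p`. -/
structure C1HolderAt {E F : Type*} [NormedAddCommGroup E] [NormedSpace ℝ E]
    [NormedAddCommGroup F] [NormedSpace ℝ F] (s : ℝ) (f : E → F) (p : E) : Prop where
  contDiffAt : ContDiffAt ℝ 1 f p
  fderiv : LocHolderAt s (fderiv ℝ f) p

/-- By the chain rule the derivative is the product of Φ' ∘ f, which is C¹ and hence Hölder, with
the Hölder map f'. Two derivatives of Φ are just enough. -/
theorem C1HolderAt.smooth_comp {E F G : Type*} [NormedAddCommGroup E] [NormedSpace ℝ E]
    [NormedAddCommGroup F] [NormedSpace ℝ F] [NormedAddCommGroup G] [NormedSpace ℝ G] {s : ℝ}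
    (hs0 : 0 ≤ s) (hs1 : s ≤ 1) {Φ : F → G} {f : E → F} {p : E} (hf : C1HolderAt s f p)
    (hΦ : ContDiffAt ℝ 2 Φ (f p)) : C1HolderAt s (Φ ∘ f) p := by
  have hΦ1 : ContDiffAt ℝ 1 Φ (f p) := hΦ.of_le (by norm_num)
  refine ⟨hΦ1.comp p hf.contDiffAt, ?_⟩
  have h1 : LocHolderAt s (fun z => _root_.fderiv ℝ Φ (f z)) p :=
    LocHolderAt.of_contDiffAt hs1
      (ContDiffAt.comp p (hΦ.fderiv_right (m := 1) (by norm_num)) hf.contDiffAt)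
  refine (LocHolderAt.bilin hs0 (ContinuousLinearMap.compL ℝ E F G) h1 hf.fderiv).congr ?_
  have h2 : ∀ᶠ z in 𝓝 p, ContDiffAt ℝ 1 f z := hf.contDiffAt.eventually (by norm_num)
  have h3 : ∀ᶠ z in 𝓝 p, ContDiffAt ℝ 1 Φ (f z) :=
    hf.contDiffAt.continuousAt.eventually (hΦ1.eventually (by norm_num))
  filter_upwards [h2, h3] with z hz hz'
  exact fderiv_comp z (hz'.differentiableAt (by norm_num)) (hz.differentiableAt (by norm_num))

namespace HolderDomain

variable {α : ℝ≥0} (D : HolderDomain α)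

/-- The unit normal has local extensions with Hölder continuous derivatives. -/
theorem exists_extension_normal (hα1 : α ≤ 1) (p : D.Γ) :
    ∃ N : E3 → E3, C1HolderAt (α : ℝ) N p ∧ ∀ᶠ x : D.Γ in 𝓝 p, D.normal x = N x := by
  obtain ⟨e, f, W, hf2, hfα, hW, hpW, h⟩ := D.local_graph p p.2
  let A := e.linearIsometryEquiv
  let J : (E2 × ℝ) →L[ℝ] E3 := (A.symm.toContinuousLinearEquiv : WithLp 2 (E2 × ℝ) →L[ℝ] E3).comp
    ((WithLp.prodContinuousLinearEquiv 2 ℝ E2 ℝ).symm : (E2 × ℝ) →L[ℝ] WithLp 2 (E2 × ℝ))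
  -- The Riesz isomorphism is conjugate-linear by type; over ℝ the conjugation is trivial, and `R`
  -- is the same map as an ℝ-linear one.
  let R : (E2 →L[ℝ] ℝ) →L[ℝ] E2 := LinearMap.mkContinuous
    { toFun := fun φ => (InnerProductSpace.toDual ℝ E2).symm φ
      map_add' := fun φ ψ => by simp
      map_smul' := fun c φ => by simp } 1 fun φ => by simp
  let Λ : (E2 →L[ℝ] ℝ) →L[ℝ] E3 := -(J.comp ((ContinuousLinearMap.inl ℝ E2 ℝ).comp R))
  -- The unnormalized normal (-∇f, 1) uses only the planar coordinate of z, so it extends off the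
  -- surface. It is affine in ∇f, so its derivative is controlled by the Hölder continuous second
  -- derivative of f.
  let m : E3 → E3 := fun z => Λ (fderiv ℝ f (e z).fst) + J (0, 1)
  have hm : ∀ z, m z = A.symm (WithLp.toLp 2
      (-(InnerProductSpace.toDual ℝ E2).symm (fderiv ℝ f (e z).fst), (1 : ℝ))) := fun z => by
    have h1 : m z = J (-(InnerProductSpace.toDual ℝ E2).symm (fderiv ℝ f (e z).fst), (1 : ℝ)) := by
      have h2 : ((-(InnerProductSpace.toDual ℝ E2).symm (fderiv ℝ f (e z).fst) : E2), (1 : ℝ)) =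
          -(((InnerProductSpace.toDual ℝ E2).symm (fderiv ℝ f (e z).fst) : E2), (0 : ℝ)) +
            ((0 : E2), (1 : ℝ)) := by simp
      rw [h2, map_add, map_neg]
      rfl
    rw [h1]
    rfl
  have he : ContDiff ℝ 1 fun z : E3 => (e z).fst := by
    have h1 : ContDiff ℝ 1 (e : E3 → WithLp 2 (E2 × ℝ)) :=
      ContinuousAffineMap.contDiff (e.toContinuousAffineEquiv.toContinuousAffineMap)
    exact contDiff_fst.comp ((WithLp.prodContinuousLinearEquiv 2 ℝ E2 ℝ).contDiff.comp h1)
  let P : E3 →L[ℝ] E2 := (ContinuousLinearMap.fst ℝ E2 ℝ).comp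
    (((WithLp.prodContinuousLinearEquiv 2 ℝ E2 ℝ) : WithLp 2 (E2 × ℝ) →L[ℝ] (E2 × ℝ)).comp
      (A.toContinuousLinearEquiv : E3 →L[ℝ] WithLp 2 (E2 × ℝ)))
  have hP : ∀ z, HasFDerivAt (fun z : E3 => (e z).fst) P z := fun z => by
    have h1 : (fun w : E3 => (e w).fst) = fun w => P (w - z) + (e z).fst := by
      funext w
      have h2 : e w = A (w - z) + e z := by
        have := e.map_vadd z (w - z)
        simpa [A] using this
      rw [h2]
      rfl
    rw [h1]
    have h3 := (P.hasFDerivAt.comp z ((hasFDerivAt_id z).sub_const z)).add_const (e z).fst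
    simpa using h3
  have hdf : ContDiff ℝ 1 (fderiv ℝ f) := hf2.fderiv_right (by norm_num)
  have hmc : ContDiff ℝ 1 m := (Λ.contDiff.comp (hdf.comp he)).add contDiff_const
  have hmd : ∀ z, fderiv ℝ m z =
      Λ.comp ((fderiv ℝ (fderiv ℝ f) (e z).fst).comp P) := fun z => by
    have h1 : HasFDerivAt (fderiv ℝ f) (fderiv ℝ (fderiv ℝ f) (e z).fst) (e z).fst :=
      (hdf.differentiable (by norm_num)).differentiableAt.hasFDerivAt
    exact ((Λ.hasFDerivAt.comp z (h1.comp z (hP z))).add_const (J (0, 1))).fderiv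
  have hπ : LipschitzWith ‖P‖₊ fun z : E3 => (e z).fst :=
    lipschitzWith_of_nnnorm_fderiv_le (𝕜 := ℝ) (he.differentiable (by norm_num)) fun z => by
      rw [(hP z).fderiv]
  have hm1 : C1HolderAt (α : ℝ) m p := by
    refine ⟨hmc.contDiffAt, ?_⟩
    have h1 : LocHolderAt (α : ℝ) (fderiv ℝ (fderiv ℝ f) ∘ fun z : E3 => (e z).fst) (p : E3) :=
      LocHolderAt.comp_lipschitz α.coe_nonneg hπ (LocHolderAt.of_memHolder hfα)
    have h2 := LocHolderAt.clm_apply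
      ((ContinuousLinearMap.compL ℝ E3 (E2 →L[ℝ] ℝ) E3 Λ).comp
        ((ContinuousLinearMap.compL ℝ E3 E2 (E2 →L[ℝ] ℝ)).flip P)) h1
    exact h2.congr (Eventually.of_forall fun z => hmd z)
  have hmp := D.isOutwardUnitNormal_of_graph hf2 hW h p hpW (hm p)
  -- Normalization is smooth away from 0, and m p ≠ 0.
  refine ⟨(fun v : E3 => ‖v‖⁻¹ • v) ∘ m, hm1.smooth_comp α.coe_nonneg hα1 ?_, ?_⟩
  · exact ((contDiffAt_norm ℝ hmp.1).inv (norm_ne_zero_iff.mpr hmp.1)).smul contDiffAt_id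
  · filter_upwards [continuous_subtype_val.continuousAt.preimage_mem_nhds (hW.mem_nhds hpW)]
      with x hx
    exact (D.normal_unique x (D.isOutwardUnitNormal_of_graph hf2 hW h x hx (hm x)).2).symm

end HolderDomain

/-! ### Ambient and surface gradients -/

theorem cdot_toC3 (v n : E3) : cdot v (toC3 n) = ((inner ℝ n v : ℝ) : ℂ) := by
  simp [cdot, toC3, PiLp.inner_apply]

theorem cdot_clm_single (T : E3 →L[ℝ] ℂ) (v : E3) :
    cdot v (fun k => T (EuclideanSpace.single k (1 : ℝ))) = T v := by
  have h : v = ∑ k, v k • EuclideanSpace.single k (1 : ℝ) := by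
    ext i
    simp [Pi.single_apply]
  conv_rhs => rw [h, map_sum]
  simp [cdot]

theorem norm_cdot_le (v : E3) {g : Fin 3 → ℂ} {M : ℝ} (hg : ∀ k, ‖g k‖ ≤ M) :
    ‖cdot v g‖ ≤ 3 * M * ‖v‖ := by
  have h : ∀ k, ‖(v k : ℂ) * g k‖ ≤ ‖v‖ * M := fun k => by
    rw [norm_mul, Complex.norm_real]
    exact mul_le_mul (PiLp.norm_apply_le v k) (hg k) (norm_nonneg _) (norm_nonneg _)
  refine (norm_sum_le_of_le _ fun k _ => h k).trans_eq ?_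
  simp
  ring

namespace HolderDomain

variable {α : ℝ≥0} (D : HolderDomain α)

/-- `f(y) = f(x) + g · (y - x) + o(|y - x|)` as `y → x` on `Γ`, where `g` need not be
tangential. -/
def HasAmbientGradientAt (f : D.Γ → ℂ) (g : Fin 3 → ℂ) (x : D.Γ) : Prop :=
  (fun y : D.Γ => f y - f x - cdot ((y : E3) - x) g) =o[𝓝 x] (fun y : D.Γ => (y : E3) - x)

/-- The tangential part of a vector. -/
noncomputable def tangentialPart (x : D.Γ) (g : Fin 3 → ℂ) : Fin 3 → ℂ :=
  fun k => g k - cdot (D.normal x) g * (D.normal x k : ℂ)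

variable {D}

/-- On Γ the normal component of y - x is o(|y - x|), so discarding the normal part of g does not
disturb the first-order expansion. -/
theorem HasAmbientGradientAt.hasSurfaceGradientAt {f : D.Γ → ℂ} {g : Fin 3 → ℂ} {x : D.Γ}
    (h : D.HasAmbientGradientAt f g x) :
    D.HasSurfaceGradientAt f (D.tangentialPart x g) x := by
  have hn := D.normal_spec x
  have hv : ∀ v, cdot v (D.tangentialPart x g) =
      cdot v g - cdot (D.normal x) g * ((inner ℝ (D.normal x) v : ℝ) : ℂ) := fun v => by
    have : D.tangentialPart x g = g - cdot (D.normal x) g • toC3 (D.normal x) := rfl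
    rw [this, cdot_sub_right, cdot_smul_right, cdot_toC3]
  refine ⟨?_, ?_⟩
  · rw [hv, real_inner_self_eq_norm_sq, hn.1]
    simp
  · have h1 : (fun y : D.Γ => (inner ℝ (D.normal x) ((y : E3) - x) : ℝ)) =o[𝓝 x]
        (fun y : D.Γ => (y : E3) - x) := by
      have := hn.2.1
      rwa [nhdsWithin_eq_map_subtype_coe x.2, isLittleO_map] at this
    have h2 : (fun y : D.Γ => ((inner ℝ (D.normal x) ((y : E3) - x) : ℝ) : ℂ)) =o[𝓝 x]
        (fun y : D.Γ => (y : E3) - x) :=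
      IsLittleO.of_norm_left (by simpa only [Complex.norm_real] using h1.norm_left)
    refine (h.add (h2.const_mul_left (cdot (D.normal x) g))).congr_left fun y => ?_
    rw [hv]
    ring

theorem hasAmbientGradientAt_of_hasFDerivAt {f : D.Γ → ℂ} {Q : E3 → ℂ} {T : E3 →L[ℝ] ℂ} {x : D.Γ}
    (hQ : HasFDerivAt Q T x) (hf : ∀ᶠ y : D.Γ in 𝓝 x, f y = Q y) :
    D.HasAmbientGradientAt f (fun k => T (EuclideanSpace.single k 1)) x := by
  refine (hQ.isLittleO.comp_tendsto (continuous_subtype_val.tendsto x)).congr' ?_ EventuallyEq.rfl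
  filter_upwards [hf] with y hy
  rw [hy, hf.self_of_nhds, cdot_clm_single]
  rfl

theorem HasAmbientGradientAt.mul {f h : D.Γ → ℂ} {a b : Fin 3 → ℂ} {x : D.Γ}
    (hf : D.HasAmbientGradientAt f a x) (hh : D.HasAmbientGradientAt h b x)
    (hc : ContinuousAt h x) :
    D.HasAmbientGradientAt (fun y => f y * h y) (h x • a + f x • b) x := by
  have e1 : (fun y : D.Γ => (f y - f x - cdot ((y : E3) - x) a) * h y) =o[𝓝 x]
      (fun y : D.Γ => (y : E3) - x) := by
    have := hf.norm_right.mul_isBigO (hc.isBigO_one ℝ)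
    simpa using this
  have e2 : (fun y : D.Γ => cdot ((y : E3) - x) a * (h y - h x)) =o[𝓝 x]
      (fun y : D.Γ => (y : E3) - x) := by
    have h1 : (fun y : D.Γ => cdot ((y : E3) - x) a) =O[𝓝 x] (fun y : D.Γ => ‖(y : E3) - x‖) := by
      refine IsBigO.of_bound (3 * ‖a‖) (Eventually.of_forall fun y => ?_)
      rw [norm_norm]
      exact norm_cdot_le _ fun k => norm_le_pi_norm a k
    have h2 : (fun y : D.Γ => h y - h x) =o[𝓝 x] (fun _ => (1 : ℝ)) := by
      rw [isLittleO_one_iff]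
      simpa using hc.tendsto.sub_const (h x)
    have := h1.mul_isLittleO h2
    simpa using this
  refine ((e1.add e2).add (hh.const_mul_left (f x))).congr_left fun y => ?_
  rw [cdot_add_right, cdot_smul_right, cdot_smul_right]
  ring

variable (D)

/-- `q` is Lipschitz continuous with constant `L` and has the surface gradient `g`, which is
Hölder continuous with bound `M`. -/
structure IsC1Holder (q : D.Γ → ℂ) (g : D.Γ → Fin 3 → ℂ) (L M : ℝ) : Prop where
  lip_nonneg : 0 ≤ L
  lip : ∀ x y, ‖q x - q y‖ ≤ L * dist x y
  nonneg : 0 ≤ M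
  grad : ∀ x, D.HasSurfaceGradientAt q (g x) x
  holder : ∀ k, HolderBound (α : ℝ) M (fun x => g x k)

theorem locHolderAt_comp_val {E : Type*} [NormedAddCommGroup E] {s : ℝ} (hs : 0 ≤ s) {f : E3 → E}
    {p : D.Γ} (hf : LocHolderAt s f p) : LocHolderAt s (fun x : D.Γ => f x) p :=
  LocHolderAt.comp_lipschitz (g := fun x : D.Γ => (x : E3)) hs (LipschitzWith.subtype_val _) hf

/-- Source of the multipliers: Ψ will be a coordinate or a product of two. Near each point the
function is the restriction of the C^{1,α} map Ψ ∘ N, and the surface gradient is the tangential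
part of the ambient one. Compactness of Γ turns the local bounds into global ones. -/
theorem exists_isC1Holder_comp_normal (hα0 : 0 < α) (hα1 : α ≤ 1) {Ψ : E3 → ℂ}
    (hΨ : ContDiff ℝ 2 Ψ) : ∃ g L M, D.IsC1Holder (fun x => Ψ (D.normal x)) g L M := by
  have hα : (0 : ℝ) ≤ α := α.coe_nonneg
  choose N hN hNν using D.exists_extension_normal hα1
  have hQ : ∀ p, C1HolderAt (α : ℝ) (Ψ ∘ N p) p := fun p =>
    (hN p).smooth_comp hα hα1 hΨ.contDiffAt
  have hgrad : ∀ p, ∀ᶠ x : D.Γ in 𝓝 p, D.HasSurfaceGradientAt (fun x => Ψ (D.normal x))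
      (D.tangentialPart x fun k => fderiv ℝ (Ψ ∘ N p) x (EuclideanSpace.single k 1)) x := by
    intro p
    have h1 : ∀ᶠ z in 𝓝 (p : E3), ContDiffAt ℝ 1 (Ψ ∘ N p) z :=
      (hQ p).contDiffAt.eventually (by norm_num)
    filter_upwards [continuous_subtype_val.continuousAt.eventually h1,
      (hNν p).eventually_nhds] with x hx hx'
    refine (hasAmbientGradientAt_of_hasFDerivAt
      (hx.differentiableAt (by norm_num)).hasFDerivAt ?_).hasSurfaceGradientAt
    filter_upwards [hx'] with y hy
    rw [hy]
    rfl
  -- The gradient at each point comes from that point's own chart; uniqueness of the surface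
  -- gradient later identifies it near p with the formula from the single extension `N p`.
  choose g hg using fun p => (⟨_, (hgrad p).self_of_nhds⟩ :
    ∃ g, D.HasSurfaceGradientAt (fun x => Ψ (D.normal x)) g p)
  have hloc : ∀ k p, LocHolderAt (α : ℝ) (fun x => g x k) p := by
    intro k p
    let B : E3 →L[ℝ] ℂ := Complex.ofRealCLM.comp (EuclideanSpace.proj k : E3 →L[ℝ] ℝ)
    have h1 : LocHolderAt (α : ℝ)
        (fun z => fderiv ℝ (Ψ ∘ N p) z (EuclideanSpace.single k 1)) (p : E3) :=
      LocHolderAt.clm_apply (ContinuousLinearMap.apply ℝ ℂ (EuclideanSpace.single k (1 : ℝ)))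
        (hQ p).fderiv
    have hn : LocHolderAt (α : ℝ) (N p) (p : E3) :=
      LocHolderAt.of_contDiffAt hα1 (hN p).contDiffAt
    have h2 : LocHolderAt (α : ℝ) (fun z => fderiv ℝ (Ψ ∘ N p) z (N p z)) (p : E3) :=
      LocHolderAt.bilin hα (ContinuousLinearMap.id ℝ (E3 →L[ℝ] ℂ)) (hQ p).fderiv hn
    have h3 := LocHolderAt.bilin hα (ContinuousLinearMap.mul ℝ ℂ) h2
      (LocHolderAt.clm_apply B hn)
    refine (D.locHolderAt_comp_val hα (h1.sub h3)).congr ?_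
    filter_upwards [hgrad p, hNν p] with x hx hx'
    rw [(hg x).unique hx, tangentialPart, cdot_clm_single, hx']
    rfl
  choose M hM0 hM using fun k => exists_holderBound (by exact_mod_cast hα0) (hloc k)
  -- Exponent 1 gives the Lipschitz constant with respect to the distance of ℝ³, again by the
  -- local-to-global lemma.
  have hlip : ∀ p, LocHolderAt (1 : ℝ) (fun x => Ψ (D.normal x)) p := fun p =>
    (D.locHolderAt_comp_val zero_le_one
      (LocHolderAt.of_contDiffAt le_rfl (hQ p).contDiffAt)).congr (by
        filter_upwards [hNν p] with x hx
        rw [hx]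
        rfl)
  obtain ⟨L, hL0, hL⟩ := exists_norm_sub_le_of_locally one_pos hlip
  refine ⟨g, L, ∑ k, M k, hL0, fun x y => by simpa using hL x y,
    Finset.sum_nonneg fun k _ => hM0 k, hg, fun k => (hM k).mono ?_⟩
  exact Finset.single_le_sum (fun k _ => hM0 k) (Finset.mem_univ k)

end HolderDomain

/-! ### The commutator kernel and its potential -/

namespace HolderDomain

variable {α : ℝ≥0} {D : HolderDomain α}

theorem norm_coe_sub_coe (x y : D.Γ) : ‖(x : E3) - y‖ = dist x y := by
  rw [← dist_eq_norm]; rfl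

theorem laplaceKernel_eq (x y : D.Γ) :
    D.laplaceKernel x y = ((1 / (4 * Real.pi) : ℝ) : ℂ) * invDist x y := by
  rw [laplaceKernel, invDist, ← Complex.ofReal_mul, norm_coe_sub_coe]
  congr 1
  rw [← one_div, div_mul_div_comm, one_mul]

/-- The coordinate functions on the surface. -/
noncomputable def coord (D : HolderDomain α) (k : Fin 3) (x : D.Γ) : ℂ := ((x : E3) k : ℂ)

theorem continuous_coord (k : Fin 3) : Continuous (D.coord k) := by
  unfold coord
  fun_prop

theorem norm_coord_sub_le (k : Fin 3) (x y : D.Γ) :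
    ‖D.coord k x - D.coord k y‖ ≤ 1 * dist x y := by
  rw [coord, coord, ← Complex.ofReal_sub, Complex.norm_real, one_mul, ← norm_coe_sub_coe]
  exact PiLp.norm_apply_le ((x : E3) - (y : E3)) k

theorem hasAmbientGradientAt_invDist {x y : D.Γ} (hxy : x ≠ y) :
    D.HasAmbientGradientAt (fun x' => invDist x' y)
      (fun k => -((D.coord k x - D.coord k y) * invDist x y ^ 3)) x := by
  have hne : (x : E3) - y ≠ 0 := sub_ne_zero.mpr fun h => hxy (Subtype.ext h)
  have hpos : ‖(x : E3) - y‖ ≠ 0 := norm_ne_zero_iff.mpr hne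
  have h1 : HasFDerivAt (fun z : E3 => ‖z - y‖ ^ 2) (2 • innerSL ℝ ((x : E3) - y)) (x : E3) := by
    have := ((hasFDerivAt_id (x : E3)).sub_const (y : E3)).norm_sq
    simpa using this
  have h2 := (h1.sqrt (pow_ne_zero 2 hpos))
  have h3 := (hasDerivAt_inv (Real.sqrt_ne_zero'.mpr
    (by positivity : 0 < ‖(x : E3) - y‖ ^ 2))).comp_hasFDerivAt (x : E3) h2
  have h4 := Complex.ofRealCLM.hasFDerivAt.comp (x : E3) h3
  have h5 := hasAmbientGradientAt_of_hasFDerivAt (f := fun x' : D.Γ => invDist x' y) h4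
    (Eventually.of_forall fun z => by
      simp [invDist, norm_coe_sub_coe])
  convert h5 using 1
  funext k
  simp [invDist, coord, ← norm_coe_sub_coe, EuclideanSpace.inner_single_right]
  field_simp

theorem continuousAt_invDist {x y : D.Γ} (hxy : x ≠ y) :
    ContinuousAt (fun x' => invDist x' y) x := by
  unfold invDist
  exact Complex.continuous_ofReal.continuousAt.comp
    ((continuous_id.dist continuous_const).continuousAt.inv₀ (dist_pos.mpr hxy).ne')

/-- The ambient gradient in `x` of the kernel `(q(x) - q(y)) / |x - y|`. -/
noncomputable def gradKernel (q : D.Γ → ℂ) (g : D.Γ → Fin 3 → ℂ) (k : Fin 3) (x y : D.Γ) : ℂ :=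
  g x k * invDist x y - diffQuot q x y * diffQuot (D.coord k) x y * invDist x y

theorem hasAmbientGradientAt_diffQuot {q : D.Γ → ℂ} {g : D.Γ → Fin 3 → ℂ} {x y : D.Γ}
    (hq : D.HasSurfaceGradientAt q (g x) x) (hxy : x ≠ y) :
    D.HasAmbientGradientAt (fun x' => diffQuot q x' y) (fun k => gradKernel q g k x y) x := by
  have h1 : D.HasAmbientGradientAt (fun x' => q x' - q y) (g x) x :=
    hq.2.congr_left fun z => by ring
  have h2 := h1.mul (hasAmbientGradientAt_invDist hxy) (continuousAt_invDist hxy)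
  have h3 : (fun k => gradKernel q g k x y) = invDist x y • g x + (q x - q y) •
      fun k => -((D.coord k x - D.coord k y) * invDist x y ^ 3) := by
    funext k
    simp only [gradKernel, diffQuot, Pi.add_apply, Pi.smul_apply, smul_eq_mul]
    ring
  rw [h3]
  exact h2

section Potential

variable {q : D.Γ → ℂ} {g : D.Γ → Fin 3 → ℂ} {L M A : ℝ}

theorem IsC1Holder.continuous (hq : D.IsC1Holder q g L M) : Continuous q :=
  (LipschitzWith.of_dist_le_mul (K := ⟨L, hq.lip_nonneg⟩) fun x y => by
    rw [dist_eq_norm]; exact hq.lip x y).continuous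

theorem IsC1Holder.norm_gradKernel_le (hq : D.IsC1Holder q g L M) (k : Fin 3) (x y : D.Γ) :
    ‖gradKernel q g k x y‖ ≤ (M + L) * (dist x y)⁻¹ := by
  rw [gradKernel, ← sub_mul, norm_mul, norm_invDist]
  refine mul_le_mul_of_nonneg_right ((norm_sub_le _ _).trans
    (add_le_add ((hq.holder k).bound x) ?_)) (inv_nonneg.mpr dist_nonneg)
  rw [norm_mul]
  simpa using mul_le_mul (norm_diffQuot_le hq.lip_nonneg hq.lip x y)
    (norm_diffQuot_le zero_le_one (norm_coord_sub_le k) x y) (norm_nonneg _) hq.lip_nonneg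

/-- The integral operator with kernel `(q(x) - q(y)) / |x - y|`. -/
noncomputable def commPotential (q : D.Γ → ℂ) (ψ : D.Γ → ℂ) (x : D.Γ) : ℂ :=
  ∫ y, diffQuot q x y * ψ y ∂D.surfaceMeasure

/-- The ambient gradient of `commPotential`. -/
noncomputable def gradPotential (q : D.Γ → ℂ) (g : D.Γ → Fin 3 → ℂ) (ψ : D.Γ → ℂ) (x : D.Γ) :
    Fin 3 → ℂ :=
  fun k => ∫ y, gradKernel q g k x y * ψ y ∂D.surfaceMeasure

theorem aestronglyMeasurable_coe (ψ : C(D.Γ, ℂ)) :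
    AEStronglyMeasurable (fun y => ψ y) D.surfaceMeasure :=
  ψ.continuous.aestronglyMeasurable

theorem IsC1Holder.integrable_diffQuot_mul (hq : D.IsC1Holder q g L M) (ψ : C(D.Γ, ℂ)) (x : D.Γ) :
    Integrable (fun y => diffQuot q x y * ψ y) D.surfaceMeasure := by
  refine Integrable.of_bound ((measurable_diffQuot hq.continuous x).aestronglyMeasurable.mul
    (aestronglyMeasurable_coe ψ)) (L * ‖ψ‖) (Eventually.of_forall fun y => ?_)
  rw [norm_mul]
  exact mul_le_mul (norm_diffQuot_le hq.lip_nonneg hq.lip x y) (ψ.norm_coe_le_norm y)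
    (norm_nonneg _) hq.lip_nonneg

theorem integrable_invDist_mul (hα1 : α < 1) (hA : RieszBound D.surfaceMeasure α A)
    (ψ : C(D.Γ, ℂ)) (x : D.Γ) :
    Integrable (fun y => invDist x y * ψ y) D.surfaceMeasure :=
  (weaklySingular_invDist α.coe_nonneg (by exact_mod_cast hα1.le)).integrable_mul hA
    (aestronglyMeasurable_coe ψ) ψ.norm_coe_le_norm x

theorem IsC1Holder.weaklySingular (hq : D.IsC1Holder q g L M) (hα1 : α < 1) (k : Fin 3) :
    WeaklySingular (α : ℝ) (2 * (5 * (L * 1)))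
      (fun x y => diffQuot q x y * diffQuot (D.coord k) x y * invDist x y) :=
  weaklySingular_diffQuot_mul α.coe_nonneg (by exact_mod_cast hα1.le) hq.lip_nonneg zero_le_one
    hq.continuous (continuous_coord k) hq.lip (norm_coord_sub_le k)

theorem gradKernel_mul_eq (k : Fin 3) (ψ : C(D.Γ, ℂ)) (x y : D.Γ) :
    gradKernel q g k x y * ψ y = g x k * (invDist x y * ψ y) -
      diffQuot q x y * diffQuot (D.coord k) x y * invDist x y * ψ y := by
  rw [gradKernel]; ring

theorem IsC1Holder.integrable_gradKernel_mul (hq : D.IsC1Holder q g L M) (hα1 : α < 1)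
    (hA : RieszBound D.surfaceMeasure α A) (k : Fin 3) (ψ : C(D.Γ, ℂ)) (x : D.Γ) :
    Integrable (fun y => gradKernel q g k x y * ψ y) D.surfaceMeasure := by
  simp_rw [gradKernel_mul_eq]
  exact ((integrable_invDist_mul hα1 hA ψ x).const_mul _).sub
    ((hq.weaklySingular hα1 k).integrable_mul hA (aestronglyMeasurable_coe ψ)
      ψ.norm_coe_le_norm x)

/-- The gradient splits as g(x) times the potential of 1/|x - y| minus a weakly singular integral.
The first is a product of α-Hölder functions and gives 8M; the second, with kernel constant 10L,
gives 20L. -/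
theorem IsC1Holder.holderBound_gradPotential (hq : D.IsC1Holder q g L M) (hα1 : α < 1)
    (hA : RieszBound D.surfaceMeasure α A) (k : Fin 3) (ψ : C(D.Γ, ℂ)) :
    HolderBound (α : ℝ) ((8 * M + 20 * L) * A * ‖ψ‖) (fun x => gradPotential q g ψ x k) := by
  have h1 := (weaklySingular_invDist (X := D.Γ) α.coe_nonneg
    (by exact_mod_cast hα1.le)).holderBound hA (aestronglyMeasurable_coe ψ) (norm_nonneg _)
    ψ.norm_coe_le_norm
  have h2 := (hq.weaklySingular hα1 k).holderBound hA (aestronglyMeasurable_coe ψ) (norm_nonneg _)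
    ψ.norm_coe_le_norm
  have hA0 := hA.nonneg
  have h3 := (HolderBound.mul hq.nonneg (by positivity) (hq.holder k) h1).sub h2
  have h4 : (fun x => gradPotential q g ψ x k) = fun x =>
      g x k * (∫ y, invDist x y * ψ y ∂D.surfaceMeasure) -
      ∫ y, diffQuot q x y * diffQuot (D.coord k) x y * invDist x y * ψ y ∂D.surfaceMeasure := by
    funext x
    simp_rw [gradPotential, gradKernel_mul_eq]
    rw [integral_sub ((integrable_invDist_mul hα1 hA ψ x).const_mul _)
      ((hq.weaklySingular hα1 k).integrable_mul hA (aestronglyMeasurable_coe ψ)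
      ψ.norm_coe_le_norm x), integral_const_mul]
  rw [h4]
  exact h3.mono (le_of_eq (by ring))

/-- Dominated convergence applied to the Taylor remainder r(x', y) of the kernel divided by |x' -
x|. For each y ≠ x it tends to 0, and it is dominated by a multiple of 1/|x - y| uniformly in x'. -/
theorem IsC1Holder.hasAmbientGradientAt_commPotential (hq : D.IsC1Holder q g L M) (hα1 : α < 1)
    (hA : RieszBound D.surfaceMeasure α A) (ψ : C(D.Γ, ℂ)) (x : D.Γ) :
    D.HasAmbientGradientAt (commPotential q ψ) (gradPotential q g ψ x) x := by
  let r : D.Γ → D.Γ → ℂ := fun x' y => diffQuot q x' y - diffQuot q x y -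
    cdot ((x' : E3) - x) fun k => gradKernel q g k x y
  have hcm : ∀ (v : E3) (y : D.Γ), cdot v (fun k => gradKernel q g k x y) * ψ y =
      ∑ k, (v k : ℂ) * (gradKernel q g k x y * ψ y) := fun v y => by
    rw [cdot, Finset.sum_mul]
    simp only [mul_assoc]
  have hci : ∀ v : E3, Integrable (fun y => cdot v (fun k => gradKernel q g k x y) * ψ y)
      D.surfaceMeasure := fun v => by
    simp_rw [hcm]
    exact integrable_finsetSum _ fun k _ =>
      (hq.integrable_gradKernel_mul hα1 hA k ψ x).const_mul _
  have hci' : ∀ v : E3, ∫ y, cdot v (fun k => gradKernel q g k x y) * ψ y ∂D.surfaceMeasure =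
      cdot v (gradPotential q g ψ x) := fun v => by
    simp_rw [hcm]
    rw [integral_finsetSum _ fun k _ =>
      (hq.integrable_gradKernel_mul hα1 hA k ψ x).const_mul _]
    simp_rw [integral_const_mul]
    rfl
  have hri : ∀ x', Integrable (fun y => r x' y * ψ y) D.surfaceMeasure := fun x' => by
    simp only [r, sub_mul]
    exact ((hq.integrable_diffQuot_mul ψ x').sub (hq.integrable_diffQuot_mul ψ x)).sub (hci _)
  have hr : ∀ x', ∫ y, r x' y * ψ y ∂D.surfaceMeasure = commPotential q ψ x' -
      commPotential q ψ x - cdot ((x' : E3) - x) (gradPotential q g ψ x) := fun x' => by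
    simp only [r, sub_mul]
    have hs : Integrable (fun y => diffQuot q x' y * ψ y - diffQuot q x y * ψ y)
        D.surfaceMeasure := (hq.integrable_diffQuot_mul ψ x').sub (hq.integrable_diffQuot_mul ψ x)
    rw [integral_sub hs (hci _), integral_sub (hq.integrable_diffQuot_mul ψ x')
      (hq.integrable_diffQuot_mul ψ x),
      hci']
    rfl
  -- 2L bounds the increment of the quotient, and 3(M + L) the linear term, the 3 coming from
  -- `norm_cdot_le`.
  have hrb : ∀ x' y, x ≠ y → ‖r x' y‖ ≤
      (2 * L + 3 * (M + L)) * (dist x y)⁻¹ * ‖(x' : E3) - x‖ := fun x' y hxy => by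
    have h1 := norm_diffQuot_sub_le hq.lip_nonneg hq.lip hxy x'
    rw [norm_sub_rev, dist_comm x x', ← norm_coe_sub_coe x' x] at h1
    have h2 := norm_cdot_le ((x' : E3) - x) fun k => hq.norm_gradKernel_le k x y
    refine (norm_sub_le _ _).trans ((add_le_add h1 h2).trans_eq ?_)
    ring
  have hne : ∀ᵐ y ∂D.surfaceMeasure, x ≠ y := by
    rw [ae_iff]
    simpa using D.surfaceMeasure_singleton x
  have hlim : Tendsto (fun x' : D.Γ =>
      ∫ y, ((‖(x' : E3) - x‖⁻¹ : ℝ) : ℂ) * (r x' y * ψ y) ∂D.surfaceMeasure) (𝓝 x)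
      (𝓝 (∫ _, (0 : ℂ) ∂D.surfaceMeasure)) := by
    refine tendsto_integral_filter_of_dominated_convergence
      (fun y => (2 * L + 3 * (M + L)) * dist x y ^ (-1 : ℝ) * ‖ψ‖)
      (Eventually.of_forall fun x' => (hri x').aestronglyMeasurable.const_mul _)
      (Eventually.of_forall fun x' => ?_)
      (((integrable_and_integral_dist_rpow_le hA.nonneg (hA.one x)).1.const_mul _).mul_const _) ?_
    · filter_upwards [hne] with y hy
      have hnn : 0 ≤ (2 * L + 3 * (M + L)) * (dist x y)⁻¹ := by
        have := hq.lip_nonneg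
        have := hq.nonneg
        positivity
      rw [norm_mul, norm_mul, Complex.norm_real, norm_inv, norm_norm, Real.rpow_neg_one,
        ← mul_assoc]
      refine mul_le_mul ?_ (ψ.norm_coe_le_norm y) (norm_nonneg _) hnn
      rw [mul_comm, ← div_eq_mul_inv]
      exact div_le_of_le_mul₀ (norm_nonneg _) hnn (hrb x' y hy)
    · filter_upwards [hne] with y hy
      have h1 := (hasAmbientGradientAt_diffQuot (hq.grad x) hy)
      have h2 : (fun x' => r x' y) =o[𝓝 x] fun x' : D.Γ => ((‖(x' : E3) - x‖ : ℝ) : ℂ) := by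
        refine IsLittleO.of_norm_right ?_
        simp only [Complex.norm_real]
        exact h1.norm_right.norm_right
      have h3 := h2.tendsto_div_nhds_zero.mul_const (ψ y)
      rw [zero_mul] at h3
      refine h3.congr fun x' => ?_
      rw [Complex.ofReal_inv, div_eq_mul_inv]
      ring
  rw [integral_zero] at hlim
  have hfin : (fun x' => commPotential q ψ x' - commPotential q ψ x -
      cdot ((x' : E3) - x) (gradPotential q g ψ x)) =o[𝓝 x]
      fun x' : D.Γ => ((‖(x' : E3) - x‖ : ℝ) : ℂ) := by
    -- The side condition is that the remainder vanishes where |x' - x| does, that is, at x' = x.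
    refine (isLittleO_iff_tendsto fun x' hx' => ?_).mpr (hlim.congr fun x' => ?_)
    · have h0 : (x' : E3) - x = 0 := by simpa using hx'
      have : x' = x := Subtype.ext (sub_eq_zero.mp h0)
      subst this
      rw [h0]
      simp [cdot]
    · rw [integral_const_mul, hr, Complex.ofReal_inv, div_eq_mul_inv, mul_comm]
  have := hfin.norm_right
  simp only [Complex.norm_real] at this
  exact this.of_norm_right.of_norm_right

end Potential

end HolderDomain

/-! ### Compact embedding of the Hölder space -/

namespace HolderC0

variable {X : Type} [MetricSpace X] [CompactSpace X] {α : ℝ≥0}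

theorem exists_of_holderBound (hα0 : 0 < α) {f : X → ℂ} {M : ℝ} (hM : 0 ≤ M)
    (hf : HolderBound (α : ℝ) M f) : ∃ F : HolderC0 X α, (∀ x, F x = f x) ∧ ‖F‖ ≤ 2 * M := by
  lift M to ℝ≥0 using hM
  have h := hf.holderWith
  let F : HolderC0 X α := ⟨⟨f, h.continuous hα0⟩, h.memHolder⟩
  refine ⟨F, fun _ => rfl, ?_⟩
  rw [norm_def F, two_mul]
  refine add_le_add ((ContinuousMap.norm_le _ M.coe_nonneg).mpr hf.bound) ?_
  exact_mod_cast h.nnholderNorm_le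

theorem norm_toCont_le (f : HolderC0 X α) : ‖f.toCont‖ ≤ ‖f‖ := by
  rw [norm_def]
  exact le_add_of_nonneg_right (NNReal.coe_nonneg _)

variable (X α) in
/-- The embedding of the Hölder space into the continuous functions. -/
noncomputable def toContCLM : HolderC0 X α →L[ℂ] C(X, ℂ) :=
  LinearMap.mkContinuous
    { toFun := toCont, map_add' := toCont_add, map_smul' := toCont_smul } 1
    fun f => by rw [one_mul]; exact norm_toCont_le f

/-- Arzelà–Ascoli: functions in the unit ball are bounded by 1 and share the modulus of continuity d
^ α. Compactness of both commutators comes from here alone. -/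
theorem isCompactOperator_toContCLM (hα0 : 0 < α) : IsCompactOperator (toContCLM X α) := by
  let j := ContinuousMap.linearIsometryBoundedOfCompact X ℂ ℂ
  let S : Set (BoundedContinuousFunction X ℂ) :=
    (fun f : HolderC0 X α => j f.toCont) '' Metric.closedBall 0 1
  have hS : IsCompact (closure S) := by
    refine BoundedContinuousFunction.arzela_ascoli (Metric.closedBall (0 : ℂ) 1)
      (isCompact_closedBall _ _) S ?_ ?_
    · rintro _ x ⟨f, hf, rfl⟩
      rw [mem_closedBall_zero_iff] at hf ⊢
      exact (f.toCont.norm_coe_le_norm x).trans ((norm_toCont_le f).trans hf)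
    · refine Metric.equicontinuous_of_continuity_modulus (fun d : ℝ => d ^ (α : ℝ)) ?_ _ ?_
      · have : ContinuousAt (fun d : ℝ => d ^ (α : ℝ)) 0 :=
          Real.continuousAt_rpow_const _ _ (Or.inr α.coe_nonneg)
        simpa [ContinuousAt, Real.zero_rpow (NNReal.coe_ne_zero.mpr hα0.ne')] using this
      · rintro x y ⟨_, ⟨f, hf, rfl⟩⟩
        rw [mem_closedBall_zero_iff, norm_def] at hf
        have h1 : (nnHolderNorm α (f : X → ℂ) : ℝ) ≤ 1 := by linarith [norm_nonneg f.toCont]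
        have h2 := f.memHolder.holderWith.nndist_le x y
        have h3 : dist (f x) (f y) ≤ nnHolderNorm α (f : X → ℂ) * dist x y ^ (α : ℝ) := by
          exact_mod_cast h2
        exact h3.trans (mul_le_of_le_one_left (Real.rpow_nonneg dist_nonneg _) h1)
  refine (isCompactOperator_iff_image_closedBall_subset_compact
    (toContCLM X α : HolderC0 X α →ₗ[ℂ] C(X, ℂ)) one_pos).mpr
    ⟨j.symm '' closure S, hS.image j.symm.continuous, ?_⟩
  rintro _ ⟨f, hf, rfl⟩
  exact ⟨j f.toCont, subset_closure ⟨f, hf, rfl⟩, j.symm_apply_apply _⟩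

end HolderC0

/-! ### Bounded operators from C(Γ) to C^{1,α}(Γ) -/

namespace HolderDomain

variable {α : ℝ≥0} {D : HolderDomain α}

theorem HasAmbientGradientAt.continuousAt {f : D.Γ → ℂ} {g : Fin 3 → ℂ} {x : D.Γ}
    (h : D.HasAmbientGradientAt f g x) : ContinuousAt f x := by
  have h1 : (fun y : D.Γ => cdot ((y : E3) - x) g) =O[𝓝 x] (fun y : D.Γ => (y : E3) - x) :=
    IsBigO.of_bound (3 * ‖g‖) (Eventually.of_forall fun y =>
      norm_cdot_le _ fun k => norm_le_pi_norm g k)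
  have h2 : (fun y : D.Γ => f y - f x) =O[𝓝 x] (fun y : D.Γ => (y : E3) - x) :=
    (h.isBigO.add h1).congr_left fun y => by ring
  have h3 : Tendsto (fun y : D.Γ => (y : E3) - x) (𝓝 x) (𝓝 0) := by
    have : Continuous fun y : D.Γ => (y : E3) - x := by fun_prop
    simpa using this.tendsto x
  exact tendsto_sub_nhds_zero_iff.mp (h2.trans_tendsto h3)

theorem exists_holderBound_normal (hα0 : 0 < α) (hα1 : α ≤ 1) :
    ∃ M, 0 ≤ M ∧ ∀ k, HolderBound (α : ℝ) M (fun x : D.Γ => (D.normal x k : ℂ)) := by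
  have h : ∀ k, ∃ M, 0 ≤ M ∧ HolderBound (α : ℝ) M (fun x : D.Γ => (D.normal x k : ℂ)) :=
      fun k => exists_holderBound (by exact_mod_cast hα0) fun p => by
    obtain ⟨N, hN, hNν⟩ := D.exists_extension_normal hα1 p
    have h1 := LocHolderAt.clm_apply (Complex.ofRealCLM.comp (EuclideanSpace.proj k : E3 →L[ℝ] ℝ))
      (LocHolderAt.of_contDiffAt (s := (α : ℝ)) hα1 hN.contDiffAt)
    refine (D.locHolderAt_comp_val α.coe_nonneg h1).congr ?_
    filter_upwards [hNν] with x hx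
    rw [hx]
    rfl
  choose M hM0 hM using h
  exact ⟨∑ k, M k, Finset.sum_nonneg fun k _ => hM0 k, fun k =>
    (hM k).mono (Finset.single_le_sum (fun k _ => hM0 k) (Finset.mem_univ k))⟩

variable {q : D.Γ → ℂ} {g : D.Γ → Fin 3 → ℂ} {L M A : ℝ}

theorem IsC1Holder.norm_commPotential_le (hq : D.IsC1Holder q g L M) (ψ : C(D.Γ, ℂ)) (x : D.Γ) :
    ‖commPotential q ψ x‖ ≤ L * ‖ψ‖ * D.surfaceMeasure.real Set.univ := by
  refine norm_integral_le_of_norm_le_const (Eventually.of_forall fun y => ?_)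
  rw [norm_mul]
  exact mul_le_mul (norm_diffQuot_le hq.lip_nonneg hq.lip x y) (ψ.norm_coe_le_norm y)
    (norm_nonneg _) hq.lip_nonneg

/-- The integral operator with kernel `(q(x) - q(y)) / |x - y|` is bounded from `C(Γ)` to
`C^{1,α}(Γ)`. -/
theorem IsC1Holder.exists_clm_commPotential (hq : D.IsC1Holder q g L M) (hα0 : 0 < α)
    (hα1 : α < 1) (hA : RieszBound D.surfaceMeasure α A) :
    ∃ T : C(D.Γ, ℂ) →L[ℂ] D.HolderC1, ∀ ψ x, T ψ x = commPotential q ψ x := by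
  obtain ⟨N, hN0, hN⟩ := exists_holderBound_normal (D := D) hα0 hα1.le
  set B : ℝ := (8 * M + 20 * L) * A with hB
  have hL := hq.lip_nonneg
  have hM := hq.nonneg
  have hA0 := hA.nonneg
  have hB0 : 0 ≤ B := by positivity
  -- B bounds each component of the ambient gradient. Its normal part costs 12BN²: three products
  -- with ν give 6BN, and one more product with ν doubles and multiplies by N. The factor 6 is three
  -- components times the 2 of `HolderC0.exists_of_holderBound`.
  have hex : ∀ ψ : C(D.Γ, ℂ), ∃ f : D.HolderC1, (∀ x, f x = commPotential q ψ x) ∧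
      ‖f‖ ≤ (L * D.surfaceMeasure.real Set.univ + 6 * (B + 12 * B * N ^ 2)) * ‖ψ‖ := by
    intro ψ
    have hamb := fun x => hq.hasAmbientGradientAt_commPotential hα1 hA ψ x
    have hG := fun k => hq.holderBound_gradPotential hα1 hA k ψ
    have hψ := norm_nonneg ψ
    have hdot : HolderBound (α : ℝ) (∑ _ : Fin 3, 2 * (N * (B * ‖ψ‖)))
        (fun x => cdot (D.normal x) (gradPotential q g ψ x)) :=
      HolderBound.sum Finset.univ fun k =>
        HolderBound.mul hN0 (by positivity) (hN k) (hG k)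
    have htan : ∀ k, HolderBound (α : ℝ) ((B + 12 * B * N ^ 2) * ‖ψ‖)
        (fun x => D.tangentialPart x (gradPotential q g ψ x) k) := fun k =>
      ((hG k).sub (HolderBound.mul (by positivity) hN0 hdot (hN k))).mono (le_of_eq (by
        simp only [Finset.sum_const, Finset.card_univ, Fintype.card_fin, nsmul_eq_mul]
        push_cast
        ring))
    choose G hGv hGn using fun k =>
      HolderC0.exists_of_holderBound hα0 (by positivity) (htan k)
    let F : C(D.Γ, ℂ) := ⟨commPotential q ψ,
      continuous_iff_continuousAt.mpr fun x => (hamb x).continuousAt⟩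
    let f : D.HolderC1 := ⟨WithLp.toLp 1 (F, WithLp.toLp 1 G), fun x => by
      have h1 : HolderC0Vec.toFun (WithLp.toLp 1 G) x =
          D.tangentialPart x (gradPotential q g ψ x) := funext fun k => hGv k x
      change D.HasSurfaceGradientAt (commPotential q ψ) (HolderC0Vec.toFun (WithLp.toLp 1 G) x) x
      rw [h1]
      exact (hamb x).hasSurfaceGradientAt⟩
    refine ⟨f, fun _ => rfl, ?_⟩
    have h1 : ‖F‖ ≤ L * ‖ψ‖ * D.surfaceMeasure.real Set.univ :=
      (ContinuousMap.norm_le _ (by positivity)).mpr fun x => hq.norm_commPotential_le ψ x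
    have h2 : ‖(WithLp.toLp 1 G : HolderC0Vec D.Γ α)‖ ≤
        ∑ _ : Fin 3, 2 * ((B + 12 * B * N ^ 2) * ‖ψ‖) := by
      rw [PiLp.norm_eq_of_L1]
      exact Finset.sum_le_sum fun k _ => hGn k
    rw [HolderC1.norm_def]
    refine (add_le_add h1 h2).trans_eq ?_
    simp only [Finset.sum_const, Finset.card_univ, Fintype.card_fin, nsmul_eq_mul]
    push_cast
    ring
  choose T hT hTn using hex
  -- Linearity need only be checked on values, because the gradient of an element of `HolderC1` is
  -- determined by its function.
  refine ⟨LinearMap.mkContinuous { toFun := T, map_add' := ?_, map_smul' := ?_ } _ hTn, hT⟩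
  · intro ψ χ
    refine HolderC1.ext fun x => ?_
    change T (ψ + χ) x = T ψ x + T χ x
    rw [hT, hT, hT, commPotential, commPotential, commPotential,
      ← integral_add (hq.integrable_diffQuot_mul ψ x) (hq.integrable_diffQuot_mul χ x)]
    simp only [ContinuousMap.add_apply, mul_add]
  · intro c ψ
    refine HolderC1.ext fun x => ?_
    change T (c • ψ) x = c * T ψ x
    rw [hT, hT, commPotential, commPotential, ← integral_const_mul]
    simp only [ContinuousMap.smul_apply, smul_eq_mul, mul_left_comm]

theorem integrable_laplaceKernel_mul (hα1 : α < 1) (hA : RieszBound D.surfaceMeasure α A)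
    (u : C(D.Γ, ℂ)) (x : D.Γ) :
    Integrable (fun y => D.laplaceKernel x y * u y) D.surfaceMeasure := by
  simp_rw [laplaceKernel_eq, mul_assoc]
  exact (integrable_invDist_mul hα1 hA u x).const_mul _

theorem laplaceKernel_commutator_eq (q : D.Γ → ℂ) (ψ : C(D.Γ, ℂ)) (x y : D.Γ) :
    (q x - q y) * (D.laplaceKernel x y * ψ y) =
      ((1 / (4 * Real.pi) : ℝ) : ℂ) * (diffQuot q x y * ψ y) := by
  rw [laplaceKernel_eq, diffQuot]
  ring

theorem IsC1Holder.integrable_commutator (hq : D.IsC1Holder q g L M) (ψ : C(D.Γ, ℂ)) (x : D.Γ) :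
    Integrable (fun y => (q x - q y) * (D.laplaceKernel x y * ψ y)) D.surfaceMeasure := by
  simp_rw [laplaceKernel_commutator_eq]
  exact (hq.integrable_diffQuot_mul ψ x).const_mul _

/-- Absolute convergence of both single-layer integrals lets the difference be split. Continuity of
p is enough; the smoothness of the multiplier enters only in the mapping property. -/
theorem integral_commutator (hα1 : α < 1) (hA : RieszBound D.surfaceMeasure α A)
    (p ψ : C(D.Γ, ℂ)) (x : D.Γ) :
    ∫ y, (p x - p y) * (D.laplaceKernel x y * ψ y) ∂D.surfaceMeasure =
      p x * D.singleLayer ψ x - D.singleLayer (p * ψ) x := by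
  have h1 := integrable_laplaceKernel_mul hα1 hA (p * ψ) x
  simp only [ContinuousMap.mul_apply] at h1
  rw [singleLayer, singleLayer, ← integral_const_mul,
    ← integral_sub ((integrable_laplaceKernel_mul hα1 hA ψ x).const_mul _) (by simpa using h1)]
  refine integral_congr_ae (Eventually.of_forall fun y => ?_)
  simp only [Pi.mul_apply]
  ring

theorem IsC1Holder.exists_clm_commutator (hq : D.IsC1Holder q g L M) (hα0 : 0 < α)
    (hα1 : α < 1) (hA : RieszBound D.surfaceMeasure α A) :
    ∃ T : C(D.Γ, ℂ) →L[ℂ] D.HolderC1, ∀ ψ x,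
      T ψ x = ∫ y, (q x - q y) * (D.laplaceKernel x y * ψ y) ∂D.surfaceMeasure := by
  obtain ⟨T, hT⟩ := hq.exists_clm_commPotential hα0 hα1 hA
  refine ⟨((1 / (4 * Real.pi) : ℝ) : ℂ) • T, fun ψ x => ?_⟩
  simp_rw [laplaceKernel_commutator_eq]
  rw [integral_const_mul]
  change ((1 / (4 * Real.pi) : ℝ) : ℂ) * T ψ x = _
  rw [hT]
  rfl

theorem HolderC1.sum_apply {ι : Type*} (s : Finset ι) (f : ι → D.HolderC1) (x : D.Γ) :
    (∑ i ∈ s, f i) x = ∑ i ∈ s, f i x := by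
  classical
  induction s using Finset.induction_on with
  | empty => rfl
  | insert i s hi ih =>
    rw [Finset.sum_insert hi, Finset.sum_insert hi, ← ih]
    rfl

/-- A matrix of bounded operators from `C(Γ)` to `C^{1,α}(Γ)` is a compact operator from
`C^{0,α}(Γ, ℂ³)` to `C^{1,α}(Γ, ℂ³)`. -/
theorem exists_compact_of_matrix (hα0 : 0 < α) (T : Fin 3 → Fin 3 → C(D.Γ, ℂ) →L[ℂ] D.HolderC1) :
    ∃ C : HolderC0Vec D.Γ α →L[ℂ] D.HolderC1Vec,
      (∀ φ x i, (C φ).toFun x i = ∑ j, T i j (φ j).toCont x) ∧ IsCompactOperator C := by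
  let R : Fin 3 → C(D.Γ, ℂ) →L[ℂ] D.HolderC1Vec := fun j =>
    ((PiLp.continuousLinearEquiv 1 ℂ fun _ : Fin 3 => D.HolderC1).symm :
      (Fin 3 → D.HolderC1) →L[ℂ] D.HolderC1Vec).comp (ContinuousLinearMap.pi fun i => T i j)
  -- Each column factors through the compact embedding of the j-th component into C(Γ), so it is
  -- compact even though the entries T i j are only bounded.
  let Q : Fin 3 → HolderC0Vec D.Γ α →L[ℂ] D.HolderC1Vec := fun j =>
    (R j).comp ((HolderC0.toContCLM D.Γ α).comp (PiLp.proj 1 (fun _ : Fin 3 => HolderC0 D.Γ α) j))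
  have hQ : ∀ j, IsCompactOperator (Q j) := fun j =>
    ((HolderC0.isCompactOperator_toContCLM hα0).comp_clm
      (PiLp.proj 1 (fun _ : Fin 3 => HolderC0 D.Γ α) j)).clm_comp (R j)
  refine ⟨Q 0 + Q 1 + Q 2, fun φ x i => ?_, ((hQ 0).add (hQ 1)).add (hQ 2)⟩
  rw [Fin.sum_univ_three]
  rfl

variable (D) in
/-- The components of the normal as continuous functions. -/
noncomputable def normalCont (hα0 : 0 < α) (hα1 : α < 1) (k : Fin 3) : C(D.Γ, ℂ) :=
  ⟨fun x => (D.normal x k : ℂ), by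
    obtain ⟨M, hM0, hM⟩ := exists_holderBound_normal (D := D) hα0 hα1.le
    lift M to ℝ≥0 using hM0
    exact (hM k).holderWith.continuous hα0⟩

end HolderDomain

/-! ### The commutators in components -/

namespace HolderDomain

variable {α : ℝ≥0} {D : HolderDomain α} {A : ℝ}

theorem singleLayer_sub (hα1 : α < 1) (hA : RieszBound D.surfaceMeasure α A) (u v : C(D.Γ, ℂ))
    (x : D.Γ) : D.singleLayer (fun y => u y - v y) x = D.singleLayer u x - D.singleLayer v x := by
  rw [singleLayer, singleLayer, singleLayer, ← integral_sub
    (integrable_laplaceKernel_mul hα1 hA u x) (integrable_laplaceKernel_mul hα1 hA v x)]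
  simp only [mul_sub]

theorem singleLayer_sum (hα1 : α < 1) (hA : RieszBound D.surfaceMeasure α A)
    (u : Fin 3 → C(D.Γ, ℂ)) (x : D.Γ) :
    D.singleLayer (fun y => ∑ j, u j y) x = ∑ j, D.singleLayer (u j) x := by
  simp only [singleLayer]
  rw [← integral_finsetSum _ fun j _ => integrable_laplaceKernel_mul hα1 hA (u j) x]
  simp only [Finset.mul_sum]

variable (φ : HolderC0Vec D.Γ α) (x : D.Γ) (hα0 : 0 < α) (hα1 : α < 1)

/-- The function `ν · φ` as a continuous function. -/
noncomputable def normalDotCont : C(D.Γ, ℂ) := ∑ j, D.normalCont hα0 hα1 j * (φ j).toCont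

theorem normalDotCont_apply (y : D.Γ) :
    normalDotCont φ hα0 hα1 y = cdot (D.normal y) (φ.toFun y) := by
  simp only [normalDotCont, ContinuousMap.sum_apply, ContinuousMap.mul_apply]
  rfl

theorem commNormalIntegrand_apply (y : D.Γ) (i : Fin 3) :
    D.commNormalIntegrand φ.toFun x y i =
      (D.normalCont hα0 hα1 i x - D.normalCont hα0 hα1 i y) *
        (D.laplaceKernel x y * normalDotCont φ hα0 hα1 y) := by
  rw [normalDotCont_apply]
  simp only [commNormalIntegrand, Pi.smul_apply, Pi.sub_apply, smul_eq_mul, toC3, normalCont,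
    ContinuousMap.coe_mk]
  ring

theorem commTangentialIntegrand_apply (y : D.Γ) (i : Fin 3) :
    D.commTangentialIntegrand φ.toFun x y i =
      ∑ j, ((D.normalCont hα0 hα1 i * D.normalCont hα0 hα1 j : C(D.Γ, ℂ)) x -
        (D.normalCont hα0 hα1 i * D.normalCont hα0 hα1 j : C(D.Γ, ℂ)) y) *
          (D.laplaceKernel x y * (φ j).toCont y) := by
  simp only [commTangentialIntegrand, Pi.smul_apply, Pi.sub_apply, smul_eq_mul, toC3, normalCont,
    ContinuousMap.coe_mk, ContinuousMap.mul_apply, cdot, HolderC0Vec.toFun, Finset.sum_mul,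
    ← Finset.sum_sub_distrib, Finset.mul_sum]
  exact Finset.sum_congr rfl fun j _ => by ring

/-- A scalar commutator of the single layer with multiplication by ν_i, acting on the density ν·φ.
-/
theorem commNormal_apply (hA : RieszBound D.surfaceMeasure α A) (i : Fin 3) :
    D.commNormal φ.toFun x i = ∫ y, (D.normalCont hα0 hα1 i x - D.normalCont hα0 hα1 i y) *
        (D.laplaceKernel x y * normalDotCont φ hα0 hα1 y) ∂D.surfaceMeasure := by
  rw [integral_commutator hα1 hA, mul_comm]
  have h1 : D.normalDot φ.toFun = normalDotCont φ hα0 hα1 :=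
    funext fun y => (normalDotCont_apply φ hα0 hα1 y).symm
  have h2 : (fun y => D.projNormal φ.toFun y i) =
      ⇑(D.normalCont hα0 hα1 i) * ⇑(normalDotCont φ hα0 hα1) := funext fun y => by
    rw [projNormal, h1, Pi.smul_apply, smul_eq_mul, mul_comm]
    rfl
  simp only [commNormal, vecSingleLayer, Pi.sub_apply, Pi.smul_apply, smul_eq_mul, h1, h2]
  rfl

/-- The terms S₀φ_i in P_t S₀φ and S₀P_tφ cancel. What is left is minus the commutator with the
matrix of multipliers ν_i ν_j. -/
theorem commTangential_apply (hA : RieszBound D.surfaceMeasure α A) (i : Fin 3) :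
    D.commTangential φ.toFun x i = -∑ j, ∫ y,
      ((D.normalCont hα0 hα1 i * D.normalCont hα0 hα1 j : C(D.Γ, ℂ)) x -
        (D.normalCont hα0 hα1 i * D.normalCont hα0 hα1 j : C(D.Γ, ℂ)) y) *
          (D.laplaceKernel x y * (φ j).toCont y) ∂D.surfaceMeasure := by
  simp_rw [integral_commutator hα1 hA]
  have h1 : (fun y => D.projTangential φ.toFun y i) = fun y => (φ i).toCont y -
      (∑ j, D.normalCont hα0 hα1 i * D.normalCont hα0 hα1 j * (φ j).toCont : C(D.Γ, ℂ)) y := by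
    funext y
    simp only [projTangential, projNormal, normalDot, cdot, Pi.sub_apply, Pi.smul_apply,
      smul_eq_mul, ContinuousMap.sum_apply, ContinuousMap.mul_apply, Finset.sum_mul]
    refine congrArg₂ _ rfl (Finset.sum_congr rfl fun j _ => ?_)
    change (D.normal y j : ℂ) * φ j y * (D.normal y i : ℂ) =
      (D.normal y i : ℂ) * (D.normal y j : ℂ) * φ j y
    ring
  have h2 : D.vecSingleLayer (D.projTangential φ.toFun) x i = D.singleLayer (φ i).toCont x -
      ∑ j, D.singleLayer
        (D.normalCont hα0 hα1 i * D.normalCont hα0 hα1 j * (φ j).toCont : C(D.Γ, ℂ)) x := by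
    rw [vecSingleLayer, h1, singleLayer_sub hα1 hA]
    congr 1
    rw [← singleLayer_sum hα1 hA]
    congr 1
  rw [commTangential, Pi.sub_apply, h2, Finset.sum_sub_distrib]
  have h3 : D.projTangential (D.vecSingleLayer φ.toFun) x i = D.singleLayer (φ i).toCont x -
      ∑ j, (D.normalCont hα0 hα1 i * D.normalCont hα0 hα1 j : C(D.Γ, ℂ)) x *
        D.singleLayer (φ j).toCont x := by
    simp only [projTangential, projNormal, normalDot, cdot, Pi.sub_apply, Pi.smul_apply,
      smul_eq_mul, Finset.sum_mul]
    refine congrArg₂ _ rfl (Finset.sum_congr rfl fun j _ => ?_)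
    change (D.normal x j : ℂ) * D.singleLayer (φ j).toCont x * (D.normal x i : ℂ) =
      (D.normal x i : ℂ) * (D.normal x j : ℂ) * D.singleLayer (φ j).toCont x
    ring
  rw [h3]
  simp only [ContinuousMap.coe_mul]
  ring

variable (D) in
theorem exists_isC1Holder_normal (i : Fin 3) :
    ∃ g L M, D.IsC1Holder (D.normalCont hα0 hα1 i) g L M := by
  refine D.exists_isC1Holder_comp_normal hα0 hα1.le (Ψ := fun v => (v i : ℂ)) ?_
  exact (Complex.ofRealCLM.comp (EuclideanSpace.proj i : E3 →L[ℝ] ℝ)).contDiff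

variable (D) in
theorem exists_isC1Holder_normal_mul (i j : Fin 3) :
    ∃ g L M, D.IsC1Holder (D.normalCont hα0 hα1 i * D.normalCont hα0 hα1 j : C(D.Γ, ℂ)) g L M := by
  refine D.exists_isC1Holder_comp_normal hα0 hα1.le (Ψ := fun v => (v i : ℂ) * (v j : ℂ)) ?_
  exact (Complex.ofRealCLM.comp (EuclideanSpace.proj i : E3 →L[ℝ] ℝ)).contDiff.mul
    (Complex.ofRealCLM.comp (EuclideanSpace.proj j : E3 →L[ℝ] ℝ)).contDiff

end HolderDomain

theorem mainTheorem7 (α : ℝ≥0) (hα0 : 0 < α) (hα1 : α < 1) (D : HolderDomain α) :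
    -- the single-layer integrals converge absolutely for every continuous density
    (∀ (u : C(D.Γ, ℂ)) (x : D.Γ),
      Integrable (fun y => D.laplaceKernel x y * u y) D.surfaceMeasure) ∧
    -- the integral representations of the two commutators
    (∀ (φ : HolderC0Vec D.Γ α) (x : D.Γ),
      Integrable (D.commNormalIntegrand φ.toFun x) D.surfaceMeasure ∧
      D.commNormal φ.toFun x = ∫ y, D.commNormalIntegrand φ.toFun x y ∂D.surfaceMeasure) ∧
    (∀ (φ : HolderC0Vec D.Γ α) (x : D.Γ),
      Integrable (D.commTangentialIntegrand φ.toFun x) D.surfaceMeasure ∧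
      D.commTangential φ.toFun x =
        -∫ y, D.commTangentialIntegrand φ.toFun x y ∂D.surfaceMeasure) ∧
    -- the two commutators are compact linear maps from `C^{0,α}(Γ, ℂ³)` to `C^{1,α}(Γ, ℂ³)`
    (∃ C : HolderC0Vec D.Γ α →L[ℂ] D.HolderC1Vec,
      (∀ φ x, (C φ).toFun x = D.commNormal φ.toFun x) ∧ IsCompactOperator C) ∧
    (∃ C : HolderC0Vec D.Γ α →L[ℂ] D.HolderC1Vec,
      (∀ φ x, (C φ).toFun x = D.commTangential φ.toFun x) ∧ IsCompactOperator C) := by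
  obtain ⟨A, hA⟩ := D.exists_rieszBound (s := α) (by exact_mod_cast hα0) (by exact_mod_cast hα1)
  choose g L M hq using D.exists_isC1Holder_normal hα0 hα1
  choose g' L' M' hq' using D.exists_isC1Holder_normal_mul hα0 hα1
  refine ⟨HolderDomain.integrable_laplaceKernel_mul hα1 hA, fun φ x => ?_, fun φ x => ?_, ?_, ?_⟩
  · have hi : ∀ i, Integrable (fun y => D.commNormalIntegrand φ.toFun x y i)
        D.surfaceMeasure := fun i => by
      simp_rw [HolderDomain.commNormalIntegrand_apply φ x hα0 hα1]
      exact (hq i).integrable_commutator _ x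
    refine ⟨Integrable.of_eval hi, funext fun i => ?_⟩
    rw [eval_integral hi, HolderDomain.commNormal_apply φ x hα0 hα1 hA]
    simp_rw [HolderDomain.commNormalIntegrand_apply φ x hα0 hα1]
  · have hi : ∀ i, Integrable (fun y => D.commTangentialIntegrand φ.toFun x y i)
        D.surfaceMeasure := fun i => by
      simp_rw [HolderDomain.commTangentialIntegrand_apply φ x hα0 hα1]
      exact integrable_finsetSum _ fun j _ => (hq' i j).integrable_commutator _ x
    refine ⟨Integrable.of_eval hi, funext fun i => ?_⟩
    rw [Pi.neg_apply, eval_integral hi, HolderDomain.commTangential_apply φ x hα0 hα1 hA]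
    simp_rw [HolderDomain.commTangentialIntegrand_apply φ x hα0 hα1]
    rw [integral_finsetSum _ fun j _ => (hq' i j).integrable_commutator _ x]
  · choose T hT using fun i => (hq i).exists_clm_commutator hα0 hα1 hA
    -- Since ν·φ = ∑ ν_j φ_j, the entry (i, j) is multiplication by ν_j on C(Γ) followed by the
    -- commutator with ν_i.
    obtain ⟨C, hC, hCc⟩ := HolderDomain.exists_compact_of_matrix hα0 fun i j =>
      (T i).comp (ContinuousLinearMap.mul ℂ C(D.Γ, ℂ) (D.normalCont hα0 hα1 j))
    refine ⟨C, fun φ x => funext fun i => ?_, hCc⟩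
    rw [hC, HolderDomain.commNormal_apply φ x hα0 hα1 hA, ← hT, HolderDomain.normalDotCont,
      map_sum, HolderDomain.HolderC1.sum_apply]
    rfl
  · choose T hT using fun i j => (hq' i j).exists_clm_commutator hα0 hα1 hA
    -- The sign is that of the normal projector in P_t.
    obtain ⟨C, hC, hCc⟩ := HolderDomain.exists_compact_of_matrix hα0 fun i j => -(T i j)
    refine ⟨C, fun φ x => funext fun i => ?_, hCc⟩
    rw [hC, HolderDomain.commTangential_apply φ x hα0 hα1 hA, ← Finset.sum_neg_distrib]
    refine Finset.sum_congr rfl fun j _ => ?_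
    rw [← hT]
    rfl
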